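/- Let $\mathcal G_1$ be the figure-8 graph (one vertex, two loops $e_1,e_2$), let $\mathcal E^o=\{e_1,\bar e_1,e_2,\bar e_2\}$ be its directed edges, and for $l:\{e_1,e_2\}\to\mathbb R_{>0}$ let the entropy be $h(l)=\lim_{T\to\infty}\frac1T\log\#\{\gamma: l(\gamma)<T\}$, where $\gamma=(e_0,\dots,e_n=e_0)$, $n\ge1$, runs over the closed cycles of directed edges without backtracking and $l(\gamma)=\sum_{i<n}l(e_i)$. Put $\mathcal M^1=\{l>0: h(l)=1\}$. Let $\Sigma^+$ be the space of one-sided infinite paths of directed edges without backtracking and $\sigma$ the shift on it. Regard a function $\phi$ on the edges as the function $\phi(\underline e)=\phi(e_0)$ on $\Sigma^+$. For $l\in\mathcal M^1$ let $m_{-l}=v\mu/\int v\,d\mu$ be the equilibrium state of $-l$: here $(\mathcal L w)(\underline x)=\sum_{\sigma\underline y=\underline x}e^{-l(\underline y)}w(\underline y)$ is the transfer operator, $v$ is a strictly positive continuous function with $\mathcal Lv=v$, and $\mu$ is a probability measure with $\mathcal L^*\mu=\mu$. A function $\phi$ on the edges is tangent to $\mathcal M^1$ at $l$ if $\int\phi\,dm_{-l}=0$;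 its pressure norm is given by $$\|\phi\|_P^2=\mathrm{Var}(\phi,m_{-l})=\lim_{n\to\infty}\frac1n\int\Big(\sum_{i<n}\phi\circ\sigma^i-n\int\phi\,dm_{-l}\Big)^2dm_{-l}.$$ Let $d_P$ be the path distance on $\mathcal M^1$: the infimum of $\int_0^1\|\dot\gamma(t)\|_P\,dt$ over the $C^1$ curves $\gamma:[0,1]\to\mathcal M^1$ between two given points. Then: 1. For every $l\in\mathcal M^1$ the equilibrium state $m_{-l}$ exists and is unique, and the limit defining $\|\phi\|_P^2$ exists for every tangent $\phi$. 2. $\mathcal M^1=\{c(x):x>0\}$ for the smooth curve $c(x)=\Big(x,\,-\log\frac{1-e^{-x}}{1+3e^{-x}}\Big)$, where $x=l(e_1)$. 3. For every $x>0$ the vector $\dot c(x)$ is tangent to $\mathcal M^1$ at $c(x)$, and $$\|\dot c(x)\|_P^2=\frac{4e^x(e^{2x}+3)}{e^{4x}+8e^{3x}+6e^{2x}-24e^x+9}.$$ 4. $\|\dot c(x)\|_P^2\sim\frac1x$ as $x\to0^+$, and $\int_0^1\|\dot c(x)\|_P\,dx<\infty$, so the boundary point $x=0$ is reached at finite length.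 5. $d_P$ is a metric on $\mathcal M^1$, and the metric space $(\mathcal M^1,d_P)$ is not complete. -/

import Mathlib

open Filter Topology MeasureTheory Set
open scoped ENNReal ContDiff

noncomputable section

namespace MetricGraph

/-- A finite undirected multigraph (loops allowed) with vertices `V` and edges `e_0, …, e_{k-1}`.
The endpoints of every edge are listed in an arbitrary reference order. -/
structure UGraph (V : Type) (k : ℕ) where
  fst : Fin k → V
  snd : Fin k → V

/-- Directed edges: `(e, true)` is `e` run from `fst e` to `snd e`, and `(e, false)` is its
reverse. -/
abbrev DirEdge (k : ℕ) : Type := Fin k × Bool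

/-- The same edge with the opposite direction. -/
def DirEdge.bar {k : ℕ} (e : DirEdge k) : DirEdge k := (e.1, !e.2)

namespace UGraph

variable {V : Type} {k : ℕ} (G : UGraph V k)

/-- The initial vertex of a directed edge. -/
def origin (e : DirEdge k) : V := if e.2 then G.fst e.1 else G.snd e.1

/-- The terminal vertex of a directed edge. -/
def terminus (e : DirEdge k) : V := if e.2 then G.snd e.1 else G.fst e.1

/-- `A(e, e') = 1`: the edge `e'` follows `e` and is not the reverse of `e`. -/
def Adm (e e' : DirEdge k) : Prop := G.origin e' = G.terminus e ∧ e' ≠ e.bar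

/-! ### Entropy -/

/-- A closed cycle without backtracking `(e_0, e_1, …, e_n = e_0)`, `n ≥ 1`. -/
def IsClosedCycle (γ : Σ n : ℕ, (Fin (n + 1) → DirEdge k)) : Prop :=
  1 ≤ γ.1 ∧ γ.2 (Fin.last γ.1) = γ.2 0 ∧
    ∀ i : Fin γ.1, G.Adm (γ.2 i.castSucc) (γ.2 i.succ)

/-- The length `l(e_0) + ⋯ + l(e_{n-1})` of `(e_0, e_1, …, e_n)`. -/
def cycleLength (l : Fin k → ℝ) (γ : Σ n : ℕ, (Fin (n + 1) → DirEdge k)) : ℝ :=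
  ∑ i : Fin γ.1, l (γ.2 i.castSucc).1

/-- `h(l) = h`: the limit that defines the entropy of the metric graph exists and equals `h`. -/
def HasEntropy (l : Fin k → ℝ) (h : ℝ) : Prop :=
  Tendsto (fun T : ℝ =>
    1 / T * Real.log ({γ | G.IsClosedCycle γ ∧ cycleLength l γ < T}.ncard : ℝ)) atTop (𝓝 h)

/-- The space of all positive edge weightings of entropy one. -/
def entropyOne : Set (Fin k → ℝ) := {l | (∀ i, 0 < l i) ∧ G.HasEntropy l 1}

/-! ### The one-sided subshift of finite type -/

/-- The space of one-sided infinite paths without backtracking, with the product topology and the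
product σ-algebra. -/
abbrev PathSpace : Type := {e : ℕ → DirEdge k // ∀ n, G.Adm (e n) (e (n + 1))}

/-- The shift map. -/
def shift (e : G.PathSpace) : G.PathSpace := ⟨fun n => e.1 (n + 1), fun n => e.2 (n + 1)⟩

/-- A function on the edges as a locally constant function of the zeroth edge of a path. -/
def edgeFun (φ : Fin k → ℝ) (e : G.PathSpace) : ℝ := φ (e.1 0).1

/-- The transfer operator `(L_f w)(x) = ∑_{σ y = x} exp (f y) * w y` (a finite sum). -/
def transfer (f w : G.PathSpace → ℝ) (x : G.PathSpace) : ℝ :=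
  ∑ᶠ (y : G.PathSpace) (_ : G.shift y = x), Real.exp (f y) * w y

/-- Ruelle–Perron–Frobenius data of `f`: an eigenvalue `β > 0` with a strictly positive continuous
eigenfunction `v` of the transfer operator (such a `β` is its spectral radius on the continuous
functions, so that the pressure of `f` is `log β`), and a probability measure `μ` that is an
eigenmeasure of the dual operator for `β`. -/
structure IsRPF (f : G.PathSpace → ℝ) (β : ℝ) (v : G.PathSpace → ℝ)
    (μ : Measure G.PathSpace) : Prop where
  beta_pos : 0 < β
  cont : Continuous v
  pos : ∀ x, 0 < v x
  eigen : ∀ x, G.transfer f v x = β * v x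
  prob : IsProbabilityMeasure μ
  dual : ∀ φ : C(G.PathSpace, ℝ), ∫ x, G.transfer f φ x ∂μ = β * ∫ x, φ x ∂μ

/-- `m` is the equilibrium state `v μ / ∫ v dμ` of the function `f` of pressure zero
(`β = 1`). -/
def IsEquilibriumState (f : G.PathSpace → ℝ) (m : Measure G.PathSpace) : Prop :=
  ∃ (v : G.PathSpace → ℝ) (μ : Measure G.PathSpace), G.IsRPF f 1 v μ ∧
    m = μ.withDensity (fun x => ENNReal.ofReal (v x / ∫ y, v y ∂μ))

open Classical in
/-- The equilibrium state of a function of pressure zero. -/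
def equilibriumState (f : G.PathSpace → ℝ) : Measure G.PathSpace :=
  if h : ∃ m, G.IsEquilibriumState f m then h.choose else 0

/-- The sequence `(1/n) ∫ (w^n - n ∫ w dμ)² dμ`, with `w^n` the `n`-th Birkhoff sum of `w`. -/
def varianceSeq (w : G.PathSpace → ℝ) (μ : Measure G.PathSpace) (n : ℕ) : ℝ :=
  1 / (n : ℝ) * ∫ x, (birkhoffSum G.shift w n x - n * ∫ y, w y ∂μ) ^ 2 ∂μ

/-- The (asymptotic) variance `Var(w, μ)`, the limit of `varianceSeq`. -/
def dynVariance (w : G.PathSpace → ℝ) (μ : Measure G.PathSpace) : ℝ :=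
  limUnder atTop (G.varianceSeq w μ)

/-! ### The pressure metric -/

/-- The measure `m_{-l}`. -/
def state (l : Fin k → ℝ) : Measure G.PathSpace := G.equilibriumState (G.edgeFun (-l))

/-- `φ` is tangent to the space of entropy-one weightings at `l`: `∫ φ dm_{-l} = 0`. -/
def IsTangent (l φ : Fin k → ℝ) : Prop := ∫ e, G.edgeFun φ e ∂(G.state l) = 0

/-- The pressure norm of `φ` at `l`: `‖φ‖_P² = Var(φ, m_{-l})`. -/
def pressureNorm (l φ : Fin k → ℝ) : ℝ := √(G.dynVariance (G.edgeFun φ) (G.state l))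

/-- The pressure length of a curve `[0,1] → M`. -/
def pressureLength (γ : ℝ → Fin k → ℝ) : ℝ≥0∞ :=
  ∫⁻ t in Icc (0 : ℝ) 1,
    ENNReal.ofReal (G.pressureNorm (γ t) (derivWithin γ (Icc (0 : ℝ) 1) t))

/-- `γ : [0,1] → M` is a continuously differentiable curve of entropy-one weightings from `p` to
`q`. -/
structure IsCurve (p q : Fin k → ℝ) (γ : ℝ → Fin k → ℝ) : Prop where
  contDiffOn : ContDiffOn ℝ 1 γ (Icc 0 1)
  mem : ∀ t ∈ Icc (0 : ℝ) 1, γ t ∈ G.entropyOne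
  source : γ 0 = p
  target : γ 1 = q

/-- The path distance of the pressure metric: the infimum of the lengths of the `C¹` curves from
`p` to `q`. -/
def pressureDist (p q : G.entropyOne) : ℝ≥0∞ :=
  ⨅ (γ : ℝ → Fin k → ℝ) (_ : G.IsCurve p q γ), G.pressureLength γ

end UGraph

/-- `d` is a (finite-valued) metric on `X`, and `X` with the metric `d` is not complete. -/
def IsIncompleteMetric {X : Type} (d : X → X → ℝ≥0∞) : Prop :=
  ∃ _ : MetricSpace X, (∀ p q : X, edist p q = d p q) ∧ ¬ CompleteSpace X

/-- The figure-8 graph: one vertex and two loops. -/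
def figureEight : UGraph Unit 2 where
  fst := fun _ => ()
  snd := fun _ => ()

/-- The curve `c(x) = (x, -log ((1 - e^{-x}) / (1 + 3 e^{-x})))`. -/
def eightCurve (x : ℝ) : Fin 2 → ℝ :=
  ![x, -Real.log ((1 - Real.exp (-x)) / (1 + 3 * Real.exp (-x)))]

end MetricGraph

end

open MetricGraph

namespace MetricGraph

/-! Write `a = exp (-l 0)` and `b = exp (-l 1)`. Every directed edge may be followed by itself and
by both directions of the other loop. On functions of the loop alone, the weighted transition matrix
is therefore a 2 × 2 matrix of trace `a + b`, and it has eigenvalue 1 exactly when `(1 - a)(1 - b) =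
4ab`. This is `IsBalanced`.

For balanced weightings a positive eigenvector gives an exact exponential solution of the
path-counting recursion, which squeezes the number of cycles between constant multiples of `exp T`
and `T * exp T`. Hence the entropy is one. Every positive weighting has a balanced multiple, and
entropy scales inversely with length, so balanced is equivalent to entropy one
(`mem_entropyOne_iff`). Solving the balance equation for `b` gives the curve.

The eigenmeasure is forced on cylinders by duality and realised by a Markov chain; the eigenfunction
is unique up to scaling by a minimum argument (`isEquilibriumState_iff`). The second eigenvalue of
the matrix is `c = a + b - 1`, and the tangent vectors are exactly its eigenvectors for the
normalised operator. Correlations are thus geometric, and the variance is `(∫ φ²)(1 + c)/(1 - c)`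
(`tendsto_varianceSeq`), which yields the explicit speed.

The space is one-dimensional, so the arc length from the end `x = 0`, finite because the speed is at
most `2 / √x`, embeds it isometrically into the line (`pressureDist_eq`). The image accumulates at 0
without containing it, so the space is incomplete. -/

/-! ### Admissibility, the balance equation and the positive eigenvectors -/

theorem figureEight_adm {e e' : DirEdge 2} : figureEight.Adm e e' ↔ e' ≠ e.bar := by
  simp [UGraph.Adm, UGraph.origin, UGraph.terminus, figureEight]

theorem DirEdge.bar_bar {k : ℕ} (e : DirEdge k) : e.bar.bar = e := by
  simp [DirEdge.bar]

theorem DirEdge.ne_bar_comm {k : ℕ} {e e' : DirEdge k} : e' ≠ e.bar ↔ e ≠ e'.bar := by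
  constructor
  · rintro h rfl
    exact h (DirEdge.bar_bar e').symm
  · rintro h rfl
    exact h (DirEdge.bar_bar e).symm

/-- The edge weightings at which the transfer operator of `-l` has pressure zero. -/
structure IsBalanced (l : Fin 2 → ℝ) : Prop where
  pos : ∀ i, 0 < l i
  eq : (1 - Real.exp (-l 0)) * (1 - Real.exp (-l 1)) = 4 * Real.exp (-l 0) * Real.exp (-l 1)

theorem IsBalanced.exp_lt_one {l : Fin 2 → ℝ} (h : IsBalanced l) (i : Fin 2) :
    Real.exp (-l i) < 1 := by
  have := h.pos i
  rw [Real.exp_lt_one_iff]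
  linarith

/-- The three successors of `e` are `e` itself and the two directions of the other loop `1 - e.1`.
This reduces sums over directed edges to 2 × 2 algebra. -/
theorem sum_ne_bar (g : Fin 2 → ℝ) (e : DirEdge 2) :
    ∑ e' : DirEdge 2 with e' ≠ e.bar, g e'.1 = g 0 + g 1 + g (1 - e.1) := by
  obtain ⟨i, b⟩ := e
  fin_cases i <;> cases b <;>
    simp [Finset.sum_filter, Fintype.sum_prod_type, DirEdge.bar] <;> ring

/-- The positive eigenvector of the weighted transition matrix (acting on successors). -/
noncomputable def forwardWeight (l : Fin 2 → ℝ) : Fin 2 → ℝ :=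
  ![2 * Real.exp (-l 0), 1 - Real.exp (-l 0)]

/-- The positive eigenvector of the weighted transition matrix (acting on predecessors). -/
noncomputable def backwardWeight (l : Fin 2 → ℝ) : Fin 2 → ℝ :=
  ![2 * Real.exp (-l 1), 1 - Real.exp (-l 0)]

theorem IsBalanced.forwardWeight_pos {l : Fin 2 → ℝ} (h : IsBalanced l) (i : Fin 2) :
    0 < forwardWeight l i := by
  have h0 := h.exp_lt_one 0
  have := Real.exp_pos (-l 0)
  fin_cases i <;> simp [forwardWeight] at * <;> linarith

theorem IsBalanced.backwardWeight_pos {l : Fin 2 → ℝ} (h : IsBalanced l) (i : Fin 2) :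
    0 < backwardWeight l i := by
  have h0 := h.exp_lt_one 0
  have := Real.exp_pos (-l 1)
  fin_cases i <;> simp [backwardWeight] at * <;> linarith

theorem IsBalanced.sum_forwardWeight {l : Fin 2 → ℝ} (h : IsBalanced l) (e : DirEdge 2) :
    Real.exp (-l e.1) * ∑ e' : DirEdge 2 with e' ≠ e.bar, forwardWeight l e'.1 =
      forwardWeight l e.1 := by
  have := h.eq
  rw [sum_ne_bar]
  obtain ⟨i, b⟩ := e
  fin_cases i <;> simp [forwardWeight] <;> linarith

/-! ### Counting paths -/

/-- One step of the recursion which counts the paths of bounded length. -/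
noncomputable def extendCount (l : Fin 2 → ℝ) (F : DirEdge 2 → ℝ → ℝ) (e : DirEdge 2) (T : ℝ) : ℝ :=
  ∑ e' : DirEdge 2 with e' ≠ e.bar, F e' (T - l e.1)

theorem extendCount_mono (l : Fin 2 → ℝ) : Monotone (extendCount l) := by
  intro F G h e T
  exact Finset.sum_le_sum fun e' _ => h e' _

open Classical in
/-- The number of paths of a single edge, which has to lie in `s`; this edge does not count for the
length. -/
noncomputable def trivialCount (s : Set (DirEdge 2)) (e : DirEdge 2) (T : ℝ) : ℝ :=
  if e ∈ s ∧ 0 < T then 1 else 0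

theorem trivialCount_nonneg (s : Set (DirEdge 2)) (e : DirEdge 2) (T : ℝ) :
    0 ≤ trivialCount s e T := by
  unfold trivialCount
  split_ifs <;> norm_num

open Classical in
/-- The paths `(e_0, …, e_n)` without backtracking from `e` to `f` of length less than `T`. -/
noncomputable def boundedPaths (l : Fin 2 → ℝ) (e f : DirEdge 2) (n : ℕ) (T : ℝ) :
    Finset (Fin (n + 1) → DirEdge 2) :=
  {γ | γ 0 = e ∧ γ (Fin.last n) = f ∧ (∀ i : Fin n, figureEight.Adm (γ i.castSucc) (γ i.succ)) ∧
    ∑ i : Fin n, l (γ i.castSucc).1 < T}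

-- Removing the first edge of a path lowers the bound by its length and leaves a path from one of
-- its successors. The last edge has no length of its own, which matches the convention for closed
-- cycles.
open Classical in
theorem card_boundedPaths (l : Fin 2 → ℝ) (f : DirEdge 2) (n : ℕ) (e : DirEdge 2) (T : ℝ) :
    ((boundedPaths l e f n T).card : ℝ) = (extendCount l)^[n] (trivialCount {f}) e T := by
  induction n generalizing e T with
  | zero =>
    simp only [Function.iterate_zero, id_eq, trivialCount, boundedPaths]
    by_cases h : e = f
    · by_cases hT : 0 < T
      · simp only [h, mem_singleton_iff, hT, and_self, if_true]
        norm_cast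
        rw [Finset.card_eq_one]
        refine ⟨fun _ => f, ?_⟩
        ext γ
        simp only [Finset.mem_filter, Finset.mem_univ, true_and, Finset.mem_singleton]
        constructor
        · rintro ⟨h0, -⟩
          ext1 i
          rw [← h0]
          exact congrArg γ (Fin.eq_zero i)
        · rintro rfl
          simp [hT]
      · simp [hT]
    · simp only [h, mem_singleton_iff, false_and, if_false]
      norm_cast
      rw [Finset.card_eq_zero, Finset.filter_eq_empty_iff]
      rintro γ - ⟨h0, h1, -⟩
      exact h (h0.symm.trans h1)
  | succ n ih =>
    rw [Function.iterate_succ_apply', extendCount, ← Finset.sum_congr rfl (fun e' _ => ih e' _)]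
    norm_cast
    rw [← Finset.card_biUnion]
    · symm
      refine Finset.card_bij (fun γ _ => Fin.cons e γ) ?_ ?_ ?_
      · intro γ hγ
        simp only [Finset.mem_biUnion, boundedPaths, Finset.mem_filter, Finset.mem_univ,
          true_and] at hγ
        obtain ⟨e', he', h0, h1, h2, h3⟩ := hγ
        simp only [boundedPaths, Finset.mem_filter, Finset.mem_univ, true_and]
        refine ⟨rfl, ?_, ?_, ?_⟩
        · rw [← Fin.succ_last, Fin.cons_succ, h1]
        · intro i
          refine Fin.cases ?_ (fun j => ?_) i
          · simpa [figureEight_adm, h0] using he'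
          · simpa [← Fin.succ_castSucc] using h2 j
        · rw [Fin.sum_univ_succ]
          simp only [← Fin.succ_castSucc, Fin.cons_succ, Fin.castSucc_zero, Fin.cons_zero]
          linarith
      · intro γ _ γ' _ h
        exact Fin.cons_right_injective _ h
      · intro γ hγ
        simp only [boundedPaths, Finset.mem_filter, Finset.mem_univ, true_and] at hγ
        obtain ⟨h0, h1, h2, h3⟩ := hγ
        refine ⟨Fin.tail γ, ?_, ?_⟩
        · simp only [Finset.mem_biUnion, boundedPaths, Finset.mem_filter, Finset.mem_univ,
            true_and]
          refine ⟨γ 1, ?_, rfl, ?_, ?_, ?_⟩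
          · have := h2 0
            simpa [figureEight_adm, h0] using this
          · simpa [Fin.tail] using h1
          · intro i
            exact h2 i.succ
          · rw [Fin.sum_univ_succ] at h3
            simp only [Fin.castSucc_zero, h0] at h3
            have : ∑ i : Fin n, l (Fin.tail γ i.castSucc).1 =
                ∑ i : Fin n, l (γ i.succ.castSucc).1 := rfl
            linarith
        · rw [← h0]
          exact Fin.cons_self_tail γ
    · intro a _ b _ hab
      rw [Function.onFun, Finset.disjoint_left]
      intro γ ha hb
      simp only [boundedPaths, Finset.mem_filter] at ha hb
      exact hab (ha.2.1.symm.trans hb.2.1)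

theorem pathCount_nonneg (l : Fin 2 → ℝ) (s : Set (DirEdge 2)) (n : ℕ) (e : DirEdge 2) (T : ℝ) :
    0 ≤ (extendCount l)^[n] (trivialCount s) e T := by
  induction n generalizing e T with
  | zero => exact trivialCount_nonneg _ _ _
  | succ n ih =>
    rw [Function.iterate_succ_apply']
    exact Finset.sum_nonneg fun e' _ => ih _ _

/-- The exact solution against which all path counts are compared: the shift of `T` by `l e`
produces the factor `exp (-l e)` of the eigenvector equation. -/
theorem extendCount_forwardWeight {l : Fin 2 → ℝ} (h : IsBalanced l) (C : ℝ) :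
    extendCount l (fun e T => C * forwardWeight l e.1 * Real.exp T) =
      fun e T => C * forwardWeight l e.1 * Real.exp T := by
  ext e T
  have h1 : Real.exp (T - l e.1) = Real.exp T * Real.exp (-l e.1) := by
    rw [← Real.exp_add]; ring_nf
  rw [extendCount, ← h.sum_forwardWeight e, h1, Finset.mul_sum, Finset.mul_sum, Finset.sum_mul]
  exact Finset.sum_congr rfl fun e' _ => by ring

theorem exists_pathCount_le {l : Fin 2 → ℝ} (h : IsBalanced l) :
    ∃ C > 0, ∀ (f : DirEdge 2) (n : ℕ) (e : DirEdge 2) (T : ℝ),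
      (extendCount l)^[n] (trivialCount {f}) e T ≤ C * Real.exp T := by
  obtain ⟨c, hc, hcle⟩ : ∃ c > 0, ∀ i, c ≤ forwardWeight l i :=
    ⟨min (forwardWeight l 0) (forwardWeight l 1),
      lt_min (h.forwardWeight_pos 0) (h.forwardWeight_pos 1), fun i => by fin_cases i <;> simp⟩
  obtain ⟨d, hd, hdle⟩ : ∃ d > 0, ∀ i, forwardWeight l i ≤ d :=
    ⟨max (forwardWeight l 0) (forwardWeight l 1),
      lt_max_of_lt_left (h.forwardWeight_pos 0), fun i => by fin_cases i <;> simp⟩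
  -- The factor `c⁻¹` makes the exponential solution at least 1 for `T > 0`, so that it dominates
  -- the initial count; monotonicity of the recursion does the rest. The factor `d` absorbs the
  -- dependence on `e`.
  refine ⟨c⁻¹ * d, by positivity, fun f n e T => ?_⟩
  have key : ∀ n, (extendCount l)^[n] (trivialCount {f}) ≤
      fun e T => c⁻¹ * forwardWeight l e.1 * Real.exp T := by
    intro n
    induction n with
    | zero =>
      intro e T
      have h1 : 1 ≤ c⁻¹ * forwardWeight l e.1 := by
        rw [inv_mul_eq_div, one_le_div hc]
        exact hcle _
      simp only [Function.iterate_zero, id_eq, trivialCount]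
      split_ifs with hT
      · exact one_le_mul_of_one_le_of_one_le h1 (Real.one_le_exp hT.2.le)
      · positivity
    | succ n ih =>
      rw [Function.iterate_succ_apply', ← extendCount_forwardWeight h]
      exact extendCount_mono l ih
  refine (key n e T).trans ?_
  change c⁻¹ * forwardWeight l e.1 * Real.exp T ≤ _
  have := hdle e.1
  gcongr

/-- Each edge has length at least `δ`, so induction on `K` reaches all `T ≤ K * δ`. The summed
counts obey the recursion with an extra 1 for the one-edge path; the additive 1/2 turns the
comparison with the exponential solution into an inductive inequality. -/
theorem exists_le_sum_pathCount {l : Fin 2 → ℝ} (h : IsBalanced l) :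
    ∃ c > 0, ∃ δ > 0, ∀ (K : ℕ) (e : DirEdge 2) (T : ℝ), T ≤ K * δ →
      c * Real.exp T ≤
        ∑ n ∈ Finset.range K, (extendCount l)^[n] (trivialCount Set.univ) e T + 1 / 2 := by
  obtain ⟨c, hc, hcle⟩ : ∃ c > 0, ∀ i, c ≤ forwardWeight l i :=
    ⟨min (forwardWeight l 0) (forwardWeight l 1),
      lt_min (h.forwardWeight_pos 0) (h.forwardWeight_pos 1), fun i => by fin_cases i <;> simp⟩
  obtain ⟨d, hd, hdle⟩ : ∃ d > 0, ∀ i, forwardWeight l i ≤ d :=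
    ⟨max (forwardWeight l 0) (forwardWeight l 1),
      lt_max_of_lt_left (h.forwardWeight_pos 0), fun i => by fin_cases i <;> simp⟩
  obtain ⟨δ, hδ, hδle⟩ : ∃ δ > 0, ∀ i, δ ≤ l i :=
    ⟨min (l 0) (l 1), lt_min (h.pos 0) (h.pos 1), fun i => by fin_cases i <;> simp⟩
  -- For `T ≤ 0` there may be no paths at all; the normalisation `1 / (2 * d)` keeps the left side
  -- below the additive 1/2.
  have hbase : ∀ (K : ℕ) (e : DirEdge 2) (T : ℝ), T ≤ 0 →
      1 / (2 * d) * forwardWeight l e.1 * Real.exp T ≤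
        ∑ n ∈ Finset.range K, (extendCount l)^[n] (trivialCount Set.univ) e T + 1 / 2 := by
    intro K e T hT
    have h1 : 1 / (2 * d) * forwardWeight l e.1 ≤ 1 / 2 := by
      calc 1 / (2 * d) * forwardWeight l e.1 ≤ 1 / (2 * d) * d := by
            have := hdle e.1
            gcongr
        _ = 1 / 2 := by field_simp
    have h2 : 0 ≤ ∑ n ∈ Finset.range K, (extendCount l)^[n] (trivialCount Set.univ) e T :=
      Finset.sum_nonneg fun n _ => pathCount_nonneg l _ n e T
    have h3 := mul_le_mul h1 (Real.exp_le_one_iff.2 hT) (Real.exp_pos T).le (by norm_num)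
    linarith
  have key : ∀ (K : ℕ) (e : DirEdge 2) (T : ℝ), T ≤ K * δ →
      1 / (2 * d) * forwardWeight l e.1 * Real.exp T ≤
        ∑ n ∈ Finset.range K, (extendCount l)^[n] (trivialCount Set.univ) e T + 1 / 2 := by
    intro K
    induction K with
    | zero => exact fun e T hT => hbase 0 e T (by simpa using hT)
    | succ K ih =>
      intro e T hT
      rcases le_or_gt T 0 with hT0 | hT0
      · exact hbase _ e T hT0
      · rw [← congrFun (congrFun (extendCount_forwardWeight h (1 / (2 * d))) e) T,
          Finset.sum_range_succ']
        have h1 : ∀ e' : DirEdge 2, 1 / (2 * d) * forwardWeight l e'.1 * Real.exp (T - l e.1) ≤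
            ∑ n ∈ Finset.range K, (extendCount l)^[n] (trivialCount Set.univ) e' (T - l e.1)
              + 1 / 2 := by
          intro e'
          apply ih
          have := hδle e.1
          push_cast at hT
          linarith
        -- The three successors contribute `3 * (1/2)`: one unit pays for the one-edge path, and the
        -- remaining 1/2 is the additive term of the claim.
        refine (Finset.sum_le_sum fun e' _ => h1 e').trans ?_
        rw [Finset.sum_add_distrib, sum_ne_bar (fun _ => 1 / 2), Finset.sum_comm]
        simp only [Function.iterate_succ_apply', Function.iterate_zero, id_eq, extendCount]
        simp only [trivialCount, Set.mem_univ, hT0, and_self, if_true]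
        linarith
  refine ⟨1 / (2 * d) * c, by positivity, δ, hδ, fun K e T hT => le_trans ?_ (key K e T hT)⟩
  have := hcle e.1
  gcongr

/-- Any two directed edges are joined through one intermediate edge, so a prescribed final edge
costs two steps and at most `2 * (l 0 + l 1)` of length. -/
theorem trivialCount_univ_le {l : Fin 2 → ℝ} (hl : ∀ i, 0 < l i) (f e : DirEdge 2) (T : ℝ) :
    trivialCount Set.univ e T ≤
      (extendCount l)^[2] (trivialCount {f}) e (T + 2 * (l 0 + l 1)) := by
  obtain ⟨g, hg, hgf⟩ : ∃ g : DirEdge 2, g ≠ e.bar ∧ f ≠ g.bar := by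
    revert e f; decide
  have hle : ∀ i, l i ≤ l 0 + l 1 := by
    have h0 := hl 0
    have h1 := hl 1
    intro i; fin_cases i <;> simp <;> linarith
  simp only [Function.iterate_succ_apply', Function.iterate_zero, id_eq, extendCount]
  have h1 : trivialCount Set.univ e T ≤
      trivialCount {f} f (T + 2 * (l 0 + l 1) - l e.1 - l g.1) := by
    have := hle e.1
    have := hle g.1
    by_cases hT : 0 < T
    · have : 0 < T + 2 * (l 0 + l 1) - l e.1 - l g.1 := by linarith
      simp [trivialCount, hT, this]
    · refine le_trans (le_of_eq ?_) (trivialCount_nonneg {f} f _)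
      simp [trivialCount, hT]
  refine h1.trans (le_trans ?_ (Finset.single_le_sum (a := g) (fun e' _ =>
    Finset.sum_nonneg fun e'' _ => trivialCount_nonneg _ _ _) (by simpa using hg)))
  exact Finset.single_le_sum (a := f)
    (f := fun e' => trivialCount {f} e' (T + 2 * (l 0 + l 1) - l e.1 - l g.1))
    (fun e'' _ => trivialCount_nonneg _ _ _) (by simpa using hgf)

theorem pathCount_univ_le {l : Fin 2 → ℝ} (hl : ∀ i, 0 < l i) (f : DirEdge 2) (n : ℕ)
    (e : DirEdge 2) (T : ℝ) :
    (extendCount l)^[n] (trivialCount Set.univ) e T ≤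
      (extendCount l)^[n + 2] (trivialCount {f}) e (T + 2 * (l 0 + l 1)) := by
  induction n generalizing e T with
  | zero => simpa using trivialCount_univ_le hl f e T
  | succ n ih =>
    rw [Function.iterate_succ_apply', show n + 1 + 2 = (n + 2) + 1 by ring,
      Function.iterate_succ_apply' _ (n + 2)]
    refine Finset.sum_le_sum fun e' _ => (ih e' _).trans_eq ?_
    ring_nf

/-! ### The entropy -/

open Classical in
/-- The closed cycles of `n` edges, `1 ≤ n < K`, of length less than `T`. -/
noncomputable def boundedCycles (l : Fin 2 → ℝ) (K : ℕ) (T : ℝ) :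
    Finset (Σ n : ℕ, (Fin (n + 1) → DirEdge 2)) :=
  (Finset.Ico 1 K).sigma fun n => Finset.univ.biUnion fun e => boundedPaths l e e n T

/-- A cycle of `n` edges has length at least `n * δ`, so the length bound forces `n < K`. In
particular the set of cycles is finite and its `ncard` is a genuine count. -/
theorem coe_boundedCycles {l : Fin 2 → ℝ} {δ : ℝ} (hδ : 0 < δ) (hl : ∀ i, δ ≤ l i)
    {K : ℕ} {T : ℝ} (hT : T ≤ K * δ) :
    {γ | figureEight.IsClosedCycle γ ∧ UGraph.cycleLength l γ < T} = boundedCycles l K T := by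
  ext ⟨n, γ⟩
  simp only [boundedCycles, UGraph.IsClosedCycle, UGraph.cycleLength, mem_ofPred_eq,
    Finset.coe_sigma, Set.mem_sigma_iff, Finset.coe_Ico, Set.mem_Ico, Finset.mem_coe,
    Finset.mem_biUnion, Finset.mem_univ, true_and, boundedPaths, Finset.mem_filter]
  constructor
  · rintro ⟨⟨h1, h2, h3⟩, h4⟩
    refine ⟨⟨h1, ?_⟩, γ 0, rfl, h2, h3, h4⟩
    have h5 : (n : ℝ) * δ ≤ ∑ i : Fin n, l (γ i.castSucc).1 := by
      calc (n : ℝ) * δ = ∑ i : Fin n, δ := by simp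
        _ ≤ _ := Finset.sum_le_sum fun i _ => hl _
    have h6 : (n : ℝ) < K := lt_of_mul_lt_mul_right (h5.trans_lt (h4.trans_le hT)) hδ.le
    exact_mod_cast h6
  · rintro ⟨⟨h1, -⟩, e, h2, h3, h4, h5⟩
    exact ⟨⟨h1, h3.trans h2.symm, h4⟩, h5⟩

theorem card_boundedCycles (l : Fin 2 → ℝ) (K : ℕ) (T : ℝ) :
    ((boundedCycles l K T).card : ℝ) = ∑ n ∈ Finset.Ico 1 K, ∑ e,
      (extendCount l)^[n] (trivialCount {e}) e T := by
  classical
  rw [boundedCycles, Finset.card_sigma]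
  push_cast
  refine Finset.sum_congr rfl fun n _ => ?_
  rw [Finset.card_biUnion]
  · push_cast
    exact Finset.sum_congr rfl fun e _ => card_boundedPaths l e n e T
  · intro a _ b _ hab
    rw [Function.onFun, Finset.disjoint_left]
    intro γ ha hb
    simp only [boundedPaths, Finset.mem_filter] at ha hb
    exact hab (ha.2.1.symm.trans hb.2.1)

/-- The number of closed cycles of length less than `T`. -/
noncomputable def cycleCount (l : Fin 2 → ℝ) (T : ℝ) : ℝ :=
  ({γ | figureEight.IsClosedCycle γ ∧ UGraph.cycleLength l γ < T}.ncard : ℝ)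

theorem exists_cycleCount_le {l : Fin 2 → ℝ} (h : IsBalanced l) :
    ∃ C > 0, ∀ T, 1 ≤ T → cycleCount l T ≤ C * T * Real.exp T := by
  obtain ⟨δ, hδ, hδle⟩ : ∃ δ > 0, ∀ i, δ ≤ l i :=
    ⟨min (l 0) (l 1), lt_min (h.pos 0) (h.pos 1), fun i => by fin_cases i <;> simp⟩
  obtain ⟨C, hC, hCle⟩ := exists_pathCount_le h
  refine ⟨4 * C * (1 / δ + 1), by positivity, fun T hT => ?_⟩
  have hK : T ≤ ⌈T / δ⌉₊ * δ := by
    rw [← div_le_iff₀ hδ]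
    exact Nat.le_ceil _
  rw [cycleCount, coe_boundedCycles hδ hδle hK, Set.ncard_coe_finset, card_boundedCycles]
  have h1 : (⌈T / δ⌉₊ : ℝ) ≤ (1 / δ + 1) * T := by
    have := (Nat.ceil_lt_add_one (show 0 ≤ T / δ by positivity)).le
    calc (⌈T / δ⌉₊ : ℝ) ≤ T / δ + 1 := this
      _ ≤ T / δ + T := by linarith
      _ = _ := by ring
  calc ∑ n ∈ Finset.Ico 1 ⌈T / δ⌉₊, ∑ e, (extendCount l)^[n] (trivialCount {e}) e T
      ≤ ∑ n ∈ Finset.range ⌈T / δ⌉₊, ∑ e : DirEdge 2, C * Real.exp T := by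
        refine (Finset.sum_le_sum fun n _ => Finset.sum_le_sum fun e _ => hCle e n e T).trans ?_
        refine Finset.sum_le_sum_of_subset_of_nonneg ?_ fun _ _ _ => by positivity
        rw [Finset.range_eq_Ico]
        exact Finset.Ico_subset_Ico_left zero_le_one
    _ = ⌈T / δ⌉₊ * (4 * C * Real.exp T) := by
        simp [mul_assoc]
    _ ≤ ((1 / δ + 1) * T) * (4 * C * Real.exp T) := by gcongr
    _ = _ := by ring

/-- Every path starting at the edge `(0, true)` extends to a closed cycle by two more steps, so
cycles based at this one edge already grow like `exp T`. -/
theorem exists_le_cycleCount {l : Fin 2 → ℝ} (h : IsBalanced l) :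
    ∃ c > 0, ∀ T, c * Real.exp T - 1 / 2 ≤ cycleCount l T := by
  obtain ⟨δ, hδ, hδle⟩ : ∃ δ > 0, ∀ i, δ ≤ l i :=
    ⟨min (l 0) (l 1), lt_min (h.pos 0) (h.pos 1), fun i => by fin_cases i <;> simp⟩
  obtain ⟨c, hc, ε, hε, hle⟩ := exists_le_sum_pathCount h
  refine ⟨c * Real.exp (-(2 * (l 0 + l 1))), by positivity, fun T => ?_⟩
  set S := T - 2 * (l 0 + l 1) with hS
  obtain ⟨K, hK⟩ := exists_nat_ge (max (T / δ) (S / ε))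
  have hKT : T ≤ K * δ := by
    rw [← div_le_iff₀ hδ]
    exact (le_max_left _ _).trans hK
  have hKS : S ≤ K * ε := by
    rw [← div_le_iff₀ hε]
    exact (le_max_right _ _).trans hK
  -- Closing up a path of `n < K` steps adds two, so cycles must be counted up to the cutoff `K +
  -- 2`.
  have hKT' : T ≤ (K + 2 : ℕ) * δ := by
    push_cast
    nlinarith
  rw [cycleCount, coe_boundedCycles hδ hδle hKT', Set.ncard_coe_finset, card_boundedCycles]
  have h1 : c * Real.exp (-(2 * (l 0 + l 1))) * Real.exp T = c * Real.exp S := by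
    rw [mul_assoc, ← Real.exp_add, hS]
    ring_nf
  rw [h1, sub_le_iff_le_add]
  refine (hle K ((0 : Fin 2), true) S hKS).trans ?_
  gcongr
  calc ∑ n ∈ Finset.range K, (extendCount l)^[n] (trivialCount Set.univ) ((0 : Fin 2), true) S
      ≤ ∑ n ∈ Finset.range K, ∑ e, (extendCount l)^[n + 2] (trivialCount {e}) e T := by
        refine Finset.sum_le_sum fun n _ => ?_
        refine (pathCount_univ_le h.pos ((0 : Fin 2), true) n _ S).trans ?_
        rw [hS, sub_add_cancel]
        exact Finset.single_le_sum (f := fun e : DirEdge 2 =>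
          (extendCount l)^[n + 2] (trivialCount {e}) e T)
          (fun e _ => pathCount_nonneg _ _ _ _ _) (Finset.mem_univ _)
    _ = ∑ n ∈ Finset.Ico 2 (K + 2), ∑ e, (extendCount l)^[n] (trivialCount {e}) e T := by
        rw [Finset.range_eq_Ico, Finset.sum_Ico_add' (fun n => ∑ e : DirEdge 2,
          (extendCount l)^[n] (trivialCount {e}) e T) 0 K 2, zero_add]
    _ ≤ _ := by
        refine Finset.sum_le_sum_of_subset_of_nonneg
          (Finset.Ico_subset_Ico_left (by norm_num)) fun n _ _ => ?_
        exact Finset.sum_nonneg fun e _ => pathCount_nonneg _ _ _ _ _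

theorem IsBalanced.hasEntropy_one {l : Fin 2 → ℝ} (h : IsBalanced l) :
    figureEight.HasEntropy l 1 := by
  obtain ⟨C, hC, hCle⟩ := exists_cycleCount_le h
  obtain ⟨c, hc, hcle⟩ := exists_le_cycleCount h
  have hlog : Tendsto (fun T : ℝ => Real.log T / T) atTop (𝓝 0) :=
    Real.isLittleO_log_id_atTop.tendsto_div_nhds_zero
  have hconst : ∀ k : ℝ, Tendsto (fun T : ℝ => k / T) atTop (𝓝 0) := fun k =>
    tendsto_const_nhds.div_atTop tendsto_id
  have hlow : Tendsto (fun T : ℝ => 1 + Real.log (c / 2) / T) atTop (𝓝 1) := by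
    simpa using (hconst (Real.log (c / 2))).const_add 1
  have hup : Tendsto (fun T : ℝ => 1 + (Real.log C / T + Real.log T / T)) atTop (𝓝 1) := by
    simpa using ((hconst (Real.log C)).add hlog).const_add 1
  have hbig : ∀ᶠ T : ℝ in atTop, 1 / c ≤ Real.exp T :=
    Real.tendsto_exp_atTop.eventually_ge_atTop _
  refine tendsto_of_tendsto_of_tendsto_of_le_of_le' hlow hup ?_ ?_
  · filter_upwards [hbig, eventually_ge_atTop 1] with T hT hT1
    have hT0 : 0 < T := by linarith
    have h1 : c / 2 * Real.exp T ≤ cycleCount l T := by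
      have := hcle T
      rw [div_le_iff₀ hc] at hT
      linarith
    have h2 := Real.log_le_log (by positivity) h1
    rw [Real.log_mul (by positivity) (by positivity), Real.log_exp] at h2
    change _ ≤ 1 / T * Real.log (cycleCount l T)
    calc 1 + Real.log (c / 2) / T = 1 / T * (Real.log (c / 2) + T) := by field_simp; ring
      _ ≤ _ := by gcongr
  · filter_upwards [hbig, eventually_ge_atTop 1] with T hT hT1
    have hT0 : 0 < T := by linarith
    have h0 : 0 < cycleCount l T := by
      have := hcle T
      rw [div_le_iff₀ hc] at hT
      linarith
    have h2 := Real.log_le_log h0 (hCle T hT1)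
    rw [Real.log_mul (by positivity) (by positivity), Real.log_mul (by positivity) (by positivity),
      Real.log_exp] at h2
    change 1 / T * Real.log (cycleCount l T) ≤ _
    calc 1 / T * Real.log (cycleCount l T) ≤ 1 / T * (Real.log C + Real.log T + T) := by gcongr
      _ = _ := by field_simp; ring

theorem HasEntropy.of_smul {l : Fin 2 → ℝ} {s : ℝ} (hs : 0 < s)
    (h : figureEight.HasEntropy (s • l) 1) : figureEight.HasEntropy l s := by
  have h1 := (h.comp (tendsto_id.const_mul_atTop hs)).const_mul s
  rw [mul_one] at h1
  refine h1.congr' ?_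
  filter_upwards [eventually_gt_atTop 0] with T hT
  have h2 : ∀ γ, UGraph.cycleLength (s • l) γ < s * T ↔ UGraph.cycleLength l γ < T := by
    intro γ
    have : UGraph.cycleLength (s • l) γ = s * UGraph.cycleLength l γ := by
      simp [UGraph.cycleLength, Finset.mul_sum]
    rw [this, mul_lt_mul_iff_right₀ hs]
  simp only [Function.comp, id, h2]
  field_simp

/-- The defect of the balance equation along the ray is -4 at `s = 0` and tends to 1 at infinity, so
it vanishes in between. -/
theorem exists_isBalanced_smul {l : Fin 2 → ℝ} (hl : ∀ i, 0 < l i) :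
    ∃ s : ℝ, 0 < s ∧ IsBalanced (s • l) := by
  set f : ℝ → ℝ := fun s => (1 - Real.exp (-(s * l 0))) * (1 - Real.exp (-(s * l 1))) -
    4 * Real.exp (-(s * l 0)) * Real.exp (-(s * l 1)) with hf
  have hlim : ∀ i, Tendsto (fun s : ℝ => Real.exp (-(s * l i))) atTop (𝓝 0) := fun i =>
    Real.tendsto_exp_neg_atTop_nhds_zero.comp (tendsto_id.atTop_mul_const (hl i))
  have hf1 : Tendsto f atTop (𝓝 1) := by
    have := (((hlim 0).const_sub 1).mul ((hlim 1).const_sub 1)).sub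
      (((hlim 0).const_mul 4).mul (hlim 1))
    simpa using this
  obtain ⟨S, hS, hS0⟩ := ((hf1.eventually_const_lt zero_lt_one).and
    (eventually_gt_atTop (0 : ℝ))).exists
  have hcont : ContinuousOn f (Icc 0 S) := by fun_prop
  have h0 : f 0 < 0 := by simp [hf]
  obtain ⟨s, hs, hs0⟩ := intermediate_value_Ioo hS0.le hcont ⟨h0, hS⟩
  refine ⟨s, hs.1, fun i => ?_, ?_⟩
  · simpa using mul_pos hs.1 (hl i)
  · simpa [hf, sub_eq_zero] using hs0

/-- If `s • l` is balanced, then `l` has entropy `s` by scaling. Uniqueness of limits then gives `s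
= 1` when `l` has entropy one. -/
theorem mem_entropyOne_iff {l : Fin 2 → ℝ} : l ∈ figureEight.entropyOne ↔ IsBalanced l := by
  constructor
  · rintro ⟨hl, h⟩
    obtain ⟨s, hs, hb⟩ := exists_isBalanced_smul hl
    have h2 := HasEntropy.of_smul hs hb.hasEntropy_one
    unfold UGraph.HasEntropy at h h2
    have h1 : s = 1 := tendsto_nhds_unique h2 h
    simpa [h1] using hb
  · intro h
    exact ⟨h.pos, h.hasEntropy_one⟩

/-! ### Parametrisation of the entropy-one weightings -/

theorem isBalanced_eightCurve {x : ℝ} (hx : 0 < x) : IsBalanced (eightCurve x) := by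
  have h0 := Real.exp_pos (-x)
  have h1 : Real.exp (-x) < 1 := by rw [Real.exp_lt_one_iff]; linarith
  have hq : 0 < (1 - Real.exp (-x)) / (1 + 3 * Real.exp (-x)) :=
    div_pos (by linarith) (by positivity)
  refine ⟨fun i => ?_, ?_⟩
  · fin_cases i
    · simpa [eightCurve] using hx
    · simp only [eightCurve, Fin.mk_one, Matrix.cons_val_one, Matrix.cons_val_fin_one,
        Left.neg_pos_iff]
      apply Real.log_neg hq
      rw [div_lt_one (by positivity)]
      linarith
  · simp only [eightCurve, Matrix.cons_val_zero, Matrix.cons_val_one, Matrix.cons_val_fin_one,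
      neg_neg, Real.exp_log hq]
    field_simp
    ring

theorem IsBalanced.eq_eightCurve {l : Fin 2 → ℝ} (h : IsBalanced l) : l = eightCurve (l 0) := by
  have h0 := Real.exp_pos (-l 0)
  have h1 : Real.exp (-l 1) = (1 - Real.exp (-l 0)) / (1 + 3 * Real.exp (-l 0)) := by
    rw [eq_div_iff (by positivity)]
    have := h.eq
    linarith
  ext i
  fin_cases i
  · simp [eightCurve]
  · simp [eightCurve, ← h1]

theorem entropyOne_eq_image : figureEight.entropyOne = eightCurve '' Ioi 0 := by
  ext l
  rw [mem_entropyOne_iff]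
  constructor
  · intro h
    exact ⟨l 0, h.pos 0, h.eq_eightCurve.symm⟩
  · rintro ⟨x, hx, rfl⟩
    exact isBalanced_eightCurve hx

/-! ### The path space of the figure-8 graph -/

theorem PathSpace.ne_bar (x : figureEight.PathSpace) (n : ℕ) : x.1 (n + 1) ≠ (x.1 n).bar :=
  figureEight_adm.1 (x.2 n)

open Classical in
/-- The path `(e, x_0, x_1, …)`; the path `x` itself if this has backtracking. -/
noncomputable def prepend (e : DirEdge 2) (x : figureEight.PathSpace) : figureEight.PathSpace :=
  if h : x.1 0 ≠ e.bar then
    ⟨fun n => Nat.casesOn n e x.1, fun n => by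
      cases n with
      | zero => exact figureEight_adm.2 h
      | succ n => exact x.2 n⟩
  else x

theorem prepend_zero {e : DirEdge 2} {x : figureEight.PathSpace} (h : x.1 0 ≠ e.bar) :
    (prepend e x).1 0 = e := by
  simp [prepend, h]

theorem prepend_succ {e : DirEdge 2} {x : figureEight.PathSpace} (h : x.1 0 ≠ e.bar) (n : ℕ) :
    (prepend e x).1 (n + 1) = x.1 n := by
  simp [prepend, h]

theorem shift_prepend {e : DirEdge 2} {x : figureEight.PathSpace} (h : x.1 0 ≠ e.bar) :
    figureEight.shift (prepend e x) = x := by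
  ext1; ext1 n
  exact prepend_succ h n

theorem prepend_shift (y : figureEight.PathSpace) :
    prepend (y.1 0) (figureEight.shift y) = y := by
  have h : (figureEight.shift y).1 0 ≠ (y.1 0).bar := PathSpace.ne_bar y 0
  ext1; ext1 n
  cases n with
  | zero => exact prepend_zero h
  | succ n => exact prepend_succ h n

theorem measurable_coord (n : ℕ) : Measurable fun x : figureEight.PathSpace => x.1 n :=
  (measurable_pi_apply n).comp measurable_subtype_coe

theorem continuous_coord (n : ℕ) : Continuous fun x : figureEight.PathSpace => x.1 n :=
  (continuous_apply n).comp continuous_subtype_val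

theorem measurable_prepend (e : DirEdge 2) : Measurable (prepend e) := by
  refine Measurable.subtype_mk (f := fun x => (prepend e x).1) (measurable_pi_lambda _ fun n => ?_)
  have h : (fun x => (prepend e x).1 n) =
      fun x => if x.1 0 ≠ e.bar then (Nat.casesOn n e x.1 : DirEdge 2) else x.1 n := by
    ext1 x
    by_cases h : x.1 0 ≠ e.bar <;> simp [prepend, h]
  rw [h]
  refine Measurable.ite ?_ ?_ (measurable_coord n)
  · exact (measurable_coord 0) (MeasurableSet.of_discrete (s := {f | f ≠ e.bar}))
  · cases n with
    | zero => exact measurable_const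
    | succ n => exact measurable_coord n

theorem transfer_eq_sum (f w : figureEight.PathSpace → ℝ) (x : figureEight.PathSpace) :
    figureEight.transfer f w x =
      ∑ e : DirEdge 2 with x.1 0 ≠ e.bar, Real.exp (f (prepend e x)) * w (prepend e x) := by
  have h : {y | figureEight.shift y = x} =
      (fun e => prepend e x) '' (↑({e | x.1 0 ≠ e.bar} : Finset (DirEdge 2)) : Set (DirEdge 2)) := by
    ext y
    simp only [mem_ofPred_eq, Finset.coe_filter, Finset.mem_univ, true_and, Set.mem_image]
    constructor
    · rintro rfl
      exact ⟨y.1 0, PathSpace.ne_bar y 0, prepend_shift y⟩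
    · rintro ⟨e, he, rfl⟩
      exact shift_prepend he
  have h2 : figureEight.transfer f w x =
      ∑ᶠ (y) (_ : y ∈ {y | figureEight.shift y = x}), Real.exp (f y) * w y := rfl
  rw [h2, h, finsum_mem_image, finsum_mem_coe_finset]
  intro e he e' he' hee
  simp only [Finset.coe_filter, Finset.mem_univ, true_and, mem_ofPred_eq] at he he'
  rw [← prepend_zero he, ← prepend_zero he']
  exact congrArg (fun y : figureEight.PathSpace => y.1 0) hee

theorem transfer_edgeFun (l : Fin 2 → ℝ) (w : figureEight.PathSpace → ℝ)
    (x : figureEight.PathSpace) :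
    figureEight.transfer (figureEight.edgeFun (-l)) w x =
      ∑ e : DirEdge 2 with x.1 0 ≠ e.bar, Real.exp (-l e.1) * w (prepend e x) := by
  rw [transfer_eq_sum]
  refine Finset.sum_congr rfl fun e he => ?_
  rw [Finset.mem_filter] at he
  simp [UGraph.edgeFun, prepend_zero he.2]

/-! ### Cylinder sets -/

/-- The paths which agree with `w` up to time `n`. -/
def pathCylinder (w : ℕ → DirEdge 2) (n : ℕ) : Set figureEight.PathSpace :=
  {x | ∀ i ≤ n, x.1 i = w i}

theorem isClopen_pathCylinder (w : ℕ → DirEdge 2) (n : ℕ) : IsClopen (pathCylinder w n) := by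
  have : pathCylinder w n = ⋂ i ∈ Finset.range (n + 1), (fun x => x.1 i) ⁻¹' {w i} := by
    ext x
    simp [pathCylinder]
  rw [this]
  exact isClopen_biInter_finset fun i _ => (isClopen_discrete _).preimage (continuous_coord i)

theorem measurableSet_pathCylinder (w : ℕ → DirEdge 2) (n : ℕ) :
    MeasurableSet (pathCylinder w n) :=
  (isClopen_pathCylinder w n).isOpen.measurableSet

theorem mem_pathCylinder_succ {w : ℕ → DirEdge 2} {n : ℕ} {x : figureEight.PathSpace} :
    x ∈ pathCylinder w (n + 1) ↔
      x.1 0 = w 0 ∧ figureEight.shift x ∈ pathCylinder (fun i => w (i + 1)) n := by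
  constructor
  · intro h
    exact ⟨h 0 (Nat.zero_le _), fun i hi => h (i + 1) (by omega)⟩
  · rintro ⟨h0, h1⟩ i hi
    cases i with
    | zero => exact h0
    | succ i => exact h1 i (by omega)

theorem mem_pathCylinder_zero {w : ℕ → DirEdge 2} {x : figureEight.PathSpace} :
    x ∈ pathCylinder w 0 ↔ x.1 0 = w 0 := by
  simp [pathCylinder]

theorem isPiSystem_pathCylinder :
    IsPiSystem {s | ∃ w n, s = pathCylinder w n} := by
  rintro _ ⟨w, n, rfl⟩ _ ⟨w', n', rfl⟩ ⟨z, hz, hz'⟩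
  refine ⟨z.1, max n n', ?_⟩
  ext x
  constructor
  · rintro ⟨h, h'⟩ i hi
    rcases le_max_iff.1 hi with hi | hi
    · rw [h i hi, hz i hi]
    · rw [h' i hi, hz' i hi]
  · intro h
    exact ⟨fun i hi => (h i (hi.trans (le_max_left _ _))).trans (hz i hi),
      fun i hi => (h i (hi.trans (le_max_right _ _))).trans (hz' i hi)⟩

theorem generateFrom_pathCylinder :
    (inferInstance : MeasurableSpace figureEight.PathSpace) =
      MeasurableSpace.generateFrom {s | ∃ w n, s = pathCylinder w n} := by
  apply le_antisymm
  · have key : ∀ (i : ℕ) (e : DirEdge 2), MeasurableSet[MeasurableSpace.generateFrom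
        {s | ∃ w n, s = pathCylinder w n}] {x : figureEight.PathSpace | x.1 i = e} := by
      intro i e
      have h : {x : figureEight.PathSpace | x.1 i = e} =
          -- A finite union over words of length `i + 1`; `Fin.ofNat` extends a word periodically to
          -- a sequence, and only its indices up to `i` matter.
          ⋃ w : {w : Fin (i + 1) → DirEdge 2 // w (Fin.last i) = e},
            pathCylinder (fun j => w.1 (Fin.ofNat (i + 1) j)) i := by
        ext x
        simp only [mem_ofPred_eq, mem_iUnion]
        constructor
        · intro hx
          refine ⟨⟨fun j => x.1 j, by simpa using hx⟩, fun j hj => ?_⟩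
          simp [Nat.mod_eq_of_lt (Nat.lt_succ_of_le hj)]
        · rintro ⟨w, hw⟩
          refine (hw i le_rfl).trans (Eq.trans ?_ w.2)
          refine congrArg w.1 ?_
          ext
          simp
      rw [h]
      exact MeasurableSet.iUnion fun w => MeasurableSpace.measurableSet_generateFrom ⟨_, _, rfl⟩
    have h2 : ∀ i, Measurable[MeasurableSpace.generateFrom {s | ∃ w n, s = pathCylinder w n}]
        fun x : figureEight.PathSpace => x.1 i := fun i =>
      @measurable_to_countable' _ _ _ _ (_) _ (key i)
    have h3 : Measurable[MeasurableSpace.generateFrom {s | ∃ w n, s = pathCylinder w n}]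
        (Subtype.val : figureEight.PathSpace → ℕ → DirEdge 2) :=
      @measurable_pi_lambda _ _ _ (_) _ _ h2
    exact h3.comap_le
  · apply MeasurableSpace.generateFrom_le
    rintro _ ⟨w, n, rfl⟩
    exact measurableSet_pathCylinder w n

theorem measureReal_univ_eq_sum (μ : Measure figureEight.PathSpace) [IsFiniteMeasure μ] :
    μ.real Set.univ = ∑ e, μ.real (pathCylinder (fun _ => e) 0) := by
  rw [← measureReal_biUnion_finset]
  · congr 1
    ext x
    simp [pathCylinder]
  · intro e _ f _ hef
    rw [Function.onFun, Set.disjoint_left]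
    intro x hx hx'
    rw [mem_pathCylinder_zero] at hx hx'
    exact hef (hx.symm.trans hx')
  · exact fun e _ => measurableSet_pathCylinder _ _

theorem measure_ext_pathCylinder {μ ν : Measure figureEight.PathSpace} [IsFiniteMeasure μ]
    [IsFiniteMeasure ν] (h : ∀ w n, μ.real (pathCylinder w n) = ν.real (pathCylinder w n)) :
    μ = ν := by
  refine ext_of_generate_finite _ generateFrom_pathCylinder isPiSystem_pathCylinder ?_ ?_
  · rintro _ ⟨w, n, rfl⟩
    rw [← measureReal_eq_measureReal_iff]
    exact h w n
  · rw [← measureReal_eq_measureReal_iff, measureReal_univ_eq_sum, measureReal_univ_eq_sum]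
    exact Finset.sum_congr rfl fun e _ => h _ _

/-! ### The eigenmeasure of the dual transfer operator -/

/-- The total weight of the directed edges. -/
noncomputable def totalWeight (l : Fin 2 → ℝ) : ℝ := 2 * (forwardWeight l 0 + forwardWeight l 1)

theorem IsBalanced.totalWeight_pos {l : Fin 2 → ℝ} (h : IsBalanced l) : 0 < totalWeight l := by
  have h0 := h.forwardWeight_pos 0
  have h1 := h.forwardWeight_pos 1
  unfold totalWeight
  positivity

theorem sum_forwardWeight_univ (l : Fin 2 → ℝ) :
    ∑ e : DirEdge 2, forwardWeight l e.1 = totalWeight l := by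
  simp [Fintype.sum_prod_type, totalWeight]
  ring

/-- The values on cylinders of a conformal measure of `-l`. -/
structure IsConformal (l : Fin 2 → ℝ) (μ : Measure figureEight.PathSpace) : Prop where
  base : ∀ w, μ.real (pathCylinder w 0) = forwardWeight l (w 0).1 / totalWeight l
  step : ∀ w n, μ.real (pathCylinder w (n + 1)) =
    if w 1 ≠ (w 0).bar then
      Real.exp (-l (w 0).1) * μ.real (pathCylinder (fun i => w (i + 1)) n) else 0

theorem IsConformal.unique {l : Fin 2 → ℝ} {μ ν : Measure figureEight.PathSpace}
    [IsFiniteMeasure μ] [IsFiniteMeasure ν] (hμ : IsConformal l μ) (hν : IsConformal l ν) :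
    μ = ν := by
  apply measure_ext_pathCylinder
  intro w n
  induction n generalizing w with
  | zero => rw [hμ.base, hν.base]
  | succ n ih => rw [hμ.step, hν.step, ih]

/-- The dual transfer operator on measures. -/
noncomputable def dualTransfer (l : Fin 2 → ℝ) (μ : Measure figureEight.PathSpace) :
    Measure figureEight.PathSpace :=
  ∑ e : DirEdge 2, ENNReal.ofReal (Real.exp (-l e.1)) •
    (μ.restrict {x | x.1 0 ≠ e.bar}).map (prepend e)

theorem measurableSet_coord_ne (e : DirEdge 2) :
    MeasurableSet {x : figureEight.PathSpace | x.1 0 ≠ e.bar} :=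
  (measurable_coord 0) (MeasurableSet.of_discrete (s := {f | f ≠ e.bar}))

instance (l : Fin 2 → ℝ) (μ : Measure figureEight.PathSpace) [IsFiniteMeasure μ] :
    IsFiniteMeasure (dualTransfer l μ) := by
  unfold dualTransfer
  have : ∀ e : DirEdge 2, IsFiniteMeasure (ENNReal.ofReal (Real.exp (-l e.1)) •
      (μ.restrict {x | x.1 0 ≠ e.bar}).map (prepend e)) := fun e =>
    Measure.smul_finite _ ENNReal.ofReal_ne_top
  infer_instance

instance : CompactSpace figureEight.PathSpace := by
  suffices h : IsClosed {e : ℕ → DirEdge 2 | ∀ n, figureEight.Adm (e n) (e (n + 1))} from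
    h.isClosedEmbedding_subtypeVal.compactSpace
  rw [show {e : ℕ → DirEdge 2 | ∀ n, figureEight.Adm (e n) (e (n + 1))} =
    ⋂ n, {e | figureEight.Adm (e n) (e (n + 1))} by ext; simp]
  refine isClosed_iInter fun n => ?_
  exact (isClosed_discrete {p : DirEdge 2 × DirEdge 2 | figureEight.Adm p.1 p.2}).preimage
    (f := fun e : ℕ → DirEdge 2 => (e n, e (n + 1))) (by fun_prop)

theorem integrable_of_continuous {μ : Measure figureEight.PathSpace} [IsFiniteMeasure μ]
    {f : figureEight.PathSpace → ℝ} (hf : Continuous f) : Integrable f μ :=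
  hf.integrable_of_hasCompactSupport (HasCompactSupport.of_compactSpace f)

theorem integral_dualTransfer (l : Fin 2 → ℝ) (μ : Measure figureEight.PathSpace)
    [IsFiniteMeasure μ] {f : figureEight.PathSpace → ℝ} (hf : Continuous f) :
    ∫ x, f x ∂(dualTransfer l μ) =
      ∫ x, figureEight.transfer (figureEight.edgeFun (-l)) f x ∂μ := by
  have hint : ∀ e, Integrable f ((μ.restrict {x | x.1 0 ≠ e.bar}).map (prepend e)) := fun e =>
    integrable_of_continuous hf
  have hint2 : ∀ e, IntegrableOn (fun x => f (prepend e x)) {x | x.1 0 ≠ e.bar} μ := fun e =>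
    (hint e).comp_measurable (measurable_prepend e)
  rw [dualTransfer, integral_finsetSum_measure fun e _ =>
    (hint e).smul_measure ENNReal.ofReal_ne_top]
  simp only [integral_smul_measure, ENNReal.toReal_ofReal (Real.exp_pos _).le]
  simp only [transfer_edgeFun, Finset.sum_filter]
  rw [integral_finsetSum]
  · refine Finset.sum_congr rfl fun e _ => ?_
    rw [integral_map (measurable_prepend e).aemeasurable hf.aestronglyMeasurable,
      ← integral_indicator (measurableSet_coord_ne e), smul_eq_mul, ← integral_const_mul]
    congr 1
    ext x
    by_cases h : x.1 0 ≠ e.bar <;> simp [h]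
  · intro e _
    have := ((hint2 e).integrable_indicator (measurableSet_coord_ne e)).const_mul
      (Real.exp (-l e.1))
    refine this.congr (ae_of_all _ fun x => ?_)
    by_cases h : x.1 0 ≠ e.bar <;> simp [h]

theorem prepend_mem_pathCylinder_succ {w : ℕ → DirEdge 2} {n : ℕ} {e : DirEdge 2}
    {x : figureEight.PathSpace} (h : x.1 0 ≠ e.bar) :
    prepend e x ∈ pathCylinder w (n + 1) ↔ e = w 0 ∧ x ∈ pathCylinder (fun i => w (i + 1)) n := by
  rw [mem_pathCylinder_succ, prepend_zero h, shift_prepend h]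

theorem prepend_mem_pathCylinder_zero {w : ℕ → DirEdge 2} {e : DirEdge 2}
    {x : figureEight.PathSpace} (h : x.1 0 ≠ e.bar) :
    prepend e x ∈ pathCylinder w 0 ↔ e = w 0 := by
  rw [mem_pathCylinder_zero, prepend_zero h]

/-- Only the preimage of `x` with first edge `w 0` can lie in the cylinder. Integrating this
identity against an eigenmeasure determines longer cylinders from shorter ones. -/
theorem transfer_indicator_succ (l : Fin 2 → ℝ) (w : ℕ → DirEdge 2) (n : ℕ)
    (x : figureEight.PathSpace) :
    figureEight.transfer (figureEight.edgeFun (-l)) ((pathCylinder w (n + 1)).indicator 1) x =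
      if w 1 ≠ (w 0).bar then
        Real.exp (-l (w 0).1) * (pathCylinder (fun i => w (i + 1)) n).indicator 1 x else 0 := by
  classical
  rw [transfer_edgeFun, Finset.sum_filter]
  have h1 : ∀ e : DirEdge 2,
      (if x.1 0 ≠ e.bar then
        Real.exp (-l e.1) * (pathCylinder w (n + 1)).indicator 1 (prepend e x) else 0) =
      if e = w 0 then (if x.1 0 ≠ (w 0).bar then Real.exp (-l (w 0).1) *
        (pathCylinder (fun i => w (i + 1)) n).indicator (1 : figureEight.PathSpace → ℝ) x else 0) else 0 := by
    intro e
    by_cases he : e = w 0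
    · subst he
      by_cases hx : x.1 0 ≠ (w 0).bar
      · simp only [hx, if_true, Set.indicator_apply, prepend_mem_pathCylinder_succ hx, true_and, Pi.one_apply,
          not_false_eq_true, ne_eq]
      · simp [hx]
    · by_cases hx : x.1 0 ≠ e.bar
      · simp [hx, prepend_mem_pathCylinder_succ hx, he]
      · simp [hx, he]
  rw [Finset.sum_congr rfl fun e _ => h1 e, Finset.sum_ite_eq' Finset.univ (w 0)]
  simp only [Finset.mem_univ, if_true]
  by_cases hx : x ∈ pathCylinder (fun i => w (i + 1)) n
  · have : x.1 0 = w 1 := hx 0 (Nat.zero_le _)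
    rw [this]
  · simp [hx]

theorem transfer_indicator_zero (l : Fin 2 → ℝ) (w : ℕ → DirEdge 2) (x : figureEight.PathSpace) :
    figureEight.transfer (figureEight.edgeFun (-l)) ((pathCylinder w 0).indicator 1) x =
      Real.exp (-l (w 0).1) * ∑ f : DirEdge 2 with f ≠ (w 0).bar,
        (pathCylinder (fun _ => f) 0).indicator 1 x := by
  classical
  rw [transfer_edgeFun, Finset.sum_filter, Finset.sum_filter]
  have h1 : ∀ e : DirEdge 2,
      (if x.1 0 ≠ e.bar then
        Real.exp (-l e.1) * (pathCylinder w 0).indicator 1 (prepend e x) else 0) =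
      if e = w 0 then (if x.1 0 ≠ (w 0).bar then Real.exp (-l (w 0).1) else 0) else 0 := by
    intro e
    by_cases he : e = w 0
    · subst he
      by_cases hx : x.1 0 ≠ (w 0).bar
      · simp [hx, prepend_mem_pathCylinder_zero hx]
      · simp [hx]
    · by_cases hx : x.1 0 ≠ e.bar
      · simp [hx, prepend_mem_pathCylinder_zero hx, he]
      · simp [hx, he]
  have h2 : ∀ f : DirEdge 2,
      (if f ≠ (w 0).bar then (pathCylinder (fun _ => f) 0).indicator (1 : figureEight.PathSpace → ℝ) x else 0) =
      if f = x.1 0 then (if x.1 0 ≠ (w 0).bar then 1 else 0) else 0 := by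
    intro f
    by_cases hf : f = x.1 0
    · subst hf
      simp [mem_pathCylinder_zero]
    · simp [mem_pathCylinder_zero, hf, Ne.symm hf]
  rw [Finset.sum_congr rfl fun e _ => h1 e, Finset.sum_congr rfl fun e _ => h2 e,
    Finset.sum_ite_eq' Finset.univ (w 0), Finset.sum_ite_eq' Finset.univ (x.1 0)]
  simp

theorem continuous_indicator_pathCylinder (w : ℕ → DirEdge 2) (n : ℕ) :
    Continuous ((pathCylinder w n).indicator (1 : figureEight.PathSpace → ℝ)) :=
  (isClopen_pathCylinder w n).continuous_indicator continuous_one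

/-- The weights of the first edge are determined by their eigenvalue equation. -/
theorem IsBalanced.eq_forwardWeight {l : Fin 2 → ℝ} (h : IsBalanced l) {q : DirEdge 2 → ℝ}
    (hq : ∀ e, q e = Real.exp (-l e.1) * ∑ f : DirEdge 2 with f ≠ e.bar, q f)
    (hsum : ∑ e, q e = 1) (e : DirEdge 2) : q e = forwardWeight l e.1 / totalWeight l := by
  have ha := h.exp_lt_one 0
  have hb := h.exp_lt_one 1
  have ha0 := Real.exp_pos (-l 0)
  have hZ := h.totalWeight_pos
  have e1 := hq (0, true)
  have e2 := hq (0, false)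
  have e3 := hq (1, true)
  have e4 := hq (1, false)
  simp [Finset.sum_filter, Fintype.sum_prod_type, DirEdge.bar] at e1 e2 e3 e4 hsum
  set a := Real.exp (-l 0)
  set b := Real.exp (-l 1)
  -- Subtracting the equations of an edge and its reverse leaves `1 - a` times the difference, so
  -- the weights are independent of the direction.
  have s0 : q (0, true) = q (0, false) := by
    have : (1 - a) * (q (0, true) - q (0, false)) = 0 := by linear_combination e1 - e2
    rcases mul_eq_zero.1 this with h | h <;> linarith
  have s1 : q (1, true) = q (1, false) := by
    have : (1 - b) * (q (1, true) - q (1, false)) = 0 := by linear_combination e3 - e4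
    rcases mul_eq_zero.1 this with h | h <;> linarith
  rw [s0, s1] at hsum e1
  rw [eq_div_iff hZ.ne']
  have hT : totalWeight l = 2 * (2 * a + (1 - a)) := by simp [totalWeight, forwardWeight, a]
  obtain ⟨i, c⟩ := e
  rw [hT]
  fin_cases i <;> cases c <;> simp [forwardWeight, s0, s1] <;>
    first
    | linear_combination 2 * e1 + 2 * a * hsum
    | linear_combination (-2) * e1 + (1 - a) * hsum

/-- Cylinders are clopen, so their indicators are continuous test functions for the dual equation.
The one-edge cylinders then satisfy the eigenvector equation with total mass 1, which has a single
solution. -/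
theorem IsBalanced.isConformal_of_dual {l : Fin 2 → ℝ} (h : IsBalanced l)
    {μ : Measure figureEight.PathSpace} [IsProbabilityMeasure μ]
    (hd : ∀ f : C(figureEight.PathSpace, ℝ),
      ∫ x, figureEight.transfer (figureEight.edgeFun (-l)) f x ∂μ = ∫ x, f x ∂μ) :
    IsConformal l μ := by
  have hcyl : ∀ w n, μ.real (pathCylinder w n) =
      ∫ x, figureEight.transfer (figureEight.edgeFun (-l)) ((pathCylinder w n).indicator 1) x ∂μ := by
    intro w n
    have := hd ⟨_, continuous_indicator_pathCylinder w n⟩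
    rw [← integral_indicator_one (measurableSet_pathCylinder w n)]
    exact this.symm
  have hint : ∀ w n, Integrable ((pathCylinder w n).indicator (1 : figureEight.PathSpace → ℝ)) μ := fun w n =>
    integrable_of_continuous (continuous_indicator_pathCylinder w n)
  refine ⟨fun w => ?_, fun w n => ?_⟩
  · have key := h.eq_forwardWeight (q := fun e => μ.real (pathCylinder (fun _ => e) 0)) ?_ ?_ (w 0)
    · rw [← key]
      congr 1
      ext x
      simp [mem_pathCylinder_zero]
    · intro e
      rw [hcyl]
      simp only [transfer_indicator_zero]
      rw [integral_const_mul, integral_finsetSum _ fun f _ => hint _ _]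
      simp only [integral_indicator_one (measurableSet_pathCylinder _ _)]
    · rw [← measureReal_univ_eq_sum, probReal_univ]
  · rw [hcyl]
    simp only [transfer_indicator_succ]
    split_ifs
    · rw [integral_const_mul, integral_indicator_one (measurableSet_pathCylinder _ _)]
    · simp

theorem IsConformal.dualTransfer_eq {l : Fin 2 → ℝ} (h : IsBalanced l)
    {μ : Measure figureEight.PathSpace} [IsProbabilityMeasure μ] (hμ : IsConformal l μ) :
    dualTransfer l μ = μ := by
  have hcyl : ∀ w n, (dualTransfer l μ).real (pathCylinder w n) =
      ∫ x, figureEight.transfer (figureEight.edgeFun (-l)) ((pathCylinder w n).indicator 1) x ∂μ := by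
    intro w n
    rw [← integral_indicator_one (measurableSet_pathCylinder w n),
      integral_dualTransfer l μ (continuous_indicator_pathCylinder w n)]
  have hint : ∀ w n, Integrable ((pathCylinder w n).indicator (1 : figureEight.PathSpace → ℝ)) μ := fun w n =>
    integrable_of_continuous (continuous_indicator_pathCylinder w n)
  apply measure_ext_pathCylinder
  intro w n
  rw [hcyl]
  cases n with
  | zero =>
    simp only [transfer_indicator_zero]
    rw [integral_const_mul, integral_finsetSum _ fun f _ => hint _ _]
    simp only [integral_indicator_one (measurableSet_pathCylinder _ _), hμ.base]
    rw [← Finset.sum_div, ← mul_div_assoc, h.sum_forwardWeight]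
  | succ n =>
    simp only [transfer_indicator_succ, hμ.step]
    split_ifs
    · rw [integral_const_mul, integral_indicator_one (measurableSet_pathCylinder _ _)]
    · simp

/-! ### Construction of the conformal measure as a Markov chain -/

/-- The transition probabilities. -/
noncomputable def transition (l : Fin 2 → ℝ) (e f : DirEdge 2) : ℝ :=
  Real.exp (-l e.1) * forwardWeight l f.1 / forwardWeight l e.1

/-- The edges which may follow `e`. -/
abbrev Successor (e : DirEdge 2) : Type := {f : DirEdge 2 // f ≠ e.bar}

theorem IsBalanced.transition_nonneg {l : Fin 2 → ℝ} (h : IsBalanced l) (e f : DirEdge 2) :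
    0 ≤ transition l e f := by
  have h1 := h.forwardWeight_pos e.1
  have h2 := h.forwardWeight_pos f.1
  unfold transition
  positivity

/-- The law of the next edge. -/
noncomputable def successorLaw {l : Fin 2 → ℝ} (h : IsBalanced l) (e : DirEdge 2) :
    PMF (Successor e) :=
  PMF.ofFintype (fun f => ENNReal.ofReal (transition l e f)) (by
    rw [← ENNReal.ofReal_sum_of_nonneg fun (f : Successor e) _ => h.transition_nonneg e f.1, ENNReal.ofReal_eq_one]
    have h1 := (h.forwardWeight_pos e.1).ne'
    rw [← Finset.sum_subtype (Finset.univ.filter fun f : DirEdge 2 => f ≠ e.bar) (by simp)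
      (fun f => transition l e f)]
    simp only [transition]
    rw [← Finset.sum_div, ← Finset.mul_sum, h.sum_forwardWeight, div_self h1])

theorem successorLaw_toMeasure {l : Fin 2 → ℝ} (h : IsBalanced l) (e f : DirEdge 2) :
    (successorLaw h e).toMeasure {g | g.1 = f} =
      if f ≠ e.bar then ENNReal.ofReal (transition l e f) else 0 := by
  split_ifs with hf
  · have : {g : Successor e | g.1 = f} = {⟨f, hf⟩} := by
      ext g
      simp [Subtype.ext_iff]
    rw [this, PMF.toMeasure_apply_singleton _ _ (MeasurableSet.singleton _)]
    simp [successorLaw]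
  · have : {g : Successor e | g.1 = f} = ∅ := by
      ext g
      simp only [mem_ofPred_eq, mem_empty_iff_false, iff_false]
      rintro rfl
      exact hf g.2
    rw [this, measure_empty]

/-- For every time and edge, a choice of the edge which follows. -/
abbrev Choices : Type := ∀ p : ℕ × DirEdge 2, Successor p.2

/-- The first edges of the path from `e` with given choices. -/
def followEdge (e : DirEdge 2) (c : Choices) : ℕ → DirEdge 2
  | 0 => e
  | n + 1 => (c (n, followEdge e c n)).1

/-- The path from `e` with given choices. -/
def followPath (e : DirEdge 2) (c : Choices) : figureEight.PathSpace :=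
  ⟨followEdge e c, fun n => figureEight_adm.2 (c (n, followEdge e c n)).2⟩

theorem measurable_followPath (e : DirEdge 2) : Measurable (followPath e) := by
  refine Measurable.subtype_mk (f := followEdge e) (measurable_pi_lambda _ fun n => ?_)
  induction n with
  | zero => exact measurable_const
  | succ n ih =>
    refine measurable_to_countable' fun f => ?_
    have : (fun c : Choices => followEdge e c (n + 1)) ⁻¹' {f} =
        ⋃ g : DirEdge 2, (fun c : Choices => followEdge e c n) ⁻¹' {g} ∩
          (fun c : Choices => c (n, g)) ⁻¹' {x | x.1 = f} := by
      ext c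
      simp [followEdge]
    rw [this]
    exact MeasurableSet.iUnion fun g => (ih (MeasurableSet.singleton g)).inter
      ((measurable_pi_apply (n, g)) MeasurableSet.of_discrete)

theorem followPath_mem_pathCylinder {e : DirEdge 2} {c : Choices} {w : ℕ → DirEdge 2} {n : ℕ} :
    followPath e c ∈ pathCylinder w n ↔ e = w 0 ∧ ∀ i < n, (c (i, w i)).1 = w (i + 1) := by
  constructor
  · intro h
    have h' : ∀ i ≤ n, followEdge e c i = w i := h
    refine ⟨h' 0 (Nat.zero_le _), fun i hi => ?_⟩
    rw [← h' i hi.le, ← h' (i + 1) hi]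
    rfl
  · rintro ⟨h0, h1⟩
    change ∀ i ≤ n, followEdge e c i = w i
    intro i hi
    induction i with
    | zero => exact h0
    | succ i ih =>
      rw [followEdge, ih (by omega)]
      exact h1 i hi

/-- The Markov measure with initial weights `forwardWeight`. -/
noncomputable def markovMeasure {l : Fin 2 → ℝ} (h : IsBalanced l) :
    Measure figureEight.PathSpace :=
  ∑ e : DirEdge 2, ENNReal.ofReal (forwardWeight l e.1 / totalWeight l) •
    (Measure.infinitePi fun p : ℕ × DirEdge 2 => (successorLaw h p.2).toMeasure).map (followPath e)

/-- Successors are drawn independently for every pair of a time and an edge, so a product measure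
suffices to build the Markov chain. -/
theorem infinitePi_followPath {l : Fin 2 → ℝ} (h : IsBalanced l) (e : DirEdge 2)
    (w : ℕ → DirEdge 2) (n : ℕ) :
    (Measure.infinitePi fun p : ℕ × DirEdge 2 => (successorLaw h p.2).toMeasure).map (followPath e)
      (pathCylinder w n) = if e = w 0 then
        ∏ i ∈ Finset.range n, (if w (i + 1) ≠ (w i).bar then
          ENNReal.ofReal (transition l (w i) (w (i + 1))) else 0) else 0 := by
  classical
  rw [Measure.map_apply (measurable_followPath e) (measurableSet_pathCylinder w n)]
  split_ifs with he
  · have hbox : followPath e ⁻¹' pathCylinder w n =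
        Set.pi (↑((Finset.range n).image fun i => (i, w i))) fun p => {g | g.1 = w (p.1 + 1)} := by
      ext c
      simp [followPath_mem_pathCylinder, he]
    rw [hbox, Measure.infinitePi_pi _ fun p _ => MeasurableSet.of_discrete, Finset.prod_image]
    · exact Finset.prod_congr rfl fun i _ => successorLaw_toMeasure h (w i) (w (i + 1))
    · intro i _ j _ hij
      exact congrArg Prod.fst hij
  · have : followPath e ⁻¹' pathCylinder w n = ∅ := by
      ext c
      simp [followPath_mem_pathCylinder, he]
    rw [this, measure_empty]

theorem markovMeasure_pathCylinder {l : Fin 2 → ℝ} (h : IsBalanced l) (w : ℕ → DirEdge 2) (n : ℕ) :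
    markovMeasure h (pathCylinder w n) = ENNReal.ofReal (forwardWeight l (w 0).1 / totalWeight l) *
      ∏ i ∈ Finset.range n, (if w (i + 1) ≠ (w i).bar then
          ENNReal.ofReal (transition l (w i) (w (i + 1))) else 0) := by
  simp only [markovMeasure, Measure.coe_finsetSum, Finset.sum_apply, Measure.smul_apply,
    infinitePi_followPath h, smul_eq_mul]
  rw [Finset.sum_eq_single (w 0)]
  · simp
  · intro e _ he
    simp [he]
  · simp

instance {l : Fin 2 → ℝ} (h : IsBalanced l) : IsProbabilityMeasure (markovMeasure h) := by
  constructor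
  have hp : ∀ e, IsProbabilityMeasure ((Measure.infinitePi fun p : ℕ × DirEdge 2 =>
      (successorLaw h p.2).toMeasure).map (followPath e)) := fun e =>
    Measure.isProbabilityMeasure_map (measurable_followPath e).aemeasurable
  simp only [markovMeasure, Measure.coe_finsetSum, Finset.sum_apply, Measure.smul_apply,
    measure_univ, smul_eq_mul, mul_one]
  rw [← ENNReal.ofReal_sum_of_nonneg fun e _ =>
    (div_pos (h.forwardWeight_pos e.1) h.totalWeight_pos).le, ← Finset.sum_div,
    sum_forwardWeight_univ, div_self h.totalWeight_pos.ne', ENNReal.ofReal_one]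

theorem isConformal_markovMeasure {l : Fin 2 → ℝ} (h : IsBalanced l) :
    IsConformal l (markovMeasure h) := by
  have hZ := h.totalWeight_pos
  refine ⟨fun w => ?_, fun w n => ?_⟩
  · rw [measureReal_def, markovMeasure_pathCylinder]
    simp [ENNReal.toReal_ofReal (div_pos (h.forwardWeight_pos (w 0).1) hZ).le]
  · have h0 := h.forwardWeight_pos (w 0).1
    have h1 := h.forwardWeight_pos (w 1).1
    rw [measureReal_def, measureReal_def, markovMeasure_pathCylinder, markovMeasure_pathCylinder,
      Finset.prod_range_succ', ENNReal.toReal_mul, ENNReal.toReal_mul, ENNReal.toReal_mul,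
      ENNReal.toReal_ofReal (by positivity)]
    simp only [zero_add]
    rw [ENNReal.toReal_ofReal (by positivity)]
    split_ifs
    · rw [ENNReal.toReal_ofReal (h.transition_nonneg _ _), transition]
      field_simp
    · simp

/-! ### Existence and uniqueness of the equilibrium state -/

theorem continuous_edgeFun (φ : Fin 2 → ℝ) : Continuous (figureEight.edgeFun φ) :=
  (continuous_of_discreteTopology (f := fun e : DirEdge 2 => φ e.1)).comp (continuous_coord 0)

theorem continuous_shift : Continuous figureEight.shift :=
  Continuous.subtype_mk (continuous_pi fun n => continuous_coord (n + 1)) _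

theorem transfer_edgeFun_edgeFun (l g : Fin 2 → ℝ) (x : figureEight.PathSpace) :
    figureEight.transfer (figureEight.edgeFun (-l)) (figureEight.edgeFun g) x =
      Real.exp (-l 0) * g 0 + Real.exp (-l 1) * g 1 +
        Real.exp (-l (1 - (x.1 0).1)) * g (1 - (x.1 0).1) := by
  rw [transfer_edgeFun, ← sum_ne_bar (fun i => Real.exp (-l i) * g i)]
  refine Finset.sum_congr (by ext e; simpa using DirEdge.ne_bar_comm) fun e he => ?_
  rw [Finset.mem_filter] at he
  simp [UGraph.edgeFun, prepend_zero (DirEdge.ne_bar_comm.1 he.2)]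

/-- All preimages `y` of `x` share the value `f (shift y) = f x`, which factors out. With duality
this turns correlations into powers of an eigenvalue. -/
theorem transfer_mul_comp_shift (l : Fin 2 → ℝ) (g f : figureEight.PathSpace → ℝ)
    (x : figureEight.PathSpace) :
    figureEight.transfer (figureEight.edgeFun (-l)) (fun y => g y * f (figureEight.shift y)) x =
      figureEight.transfer (figureEight.edgeFun (-l)) g x * f x := by
  rw [transfer_edgeFun, transfer_edgeFun, Finset.sum_mul]
  refine Finset.sum_congr rfl fun e he => ?_
  rw [Finset.mem_filter] at he
  rw [shift_prepend he.2, mul_assoc]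

theorem IsBalanced.transfer_backwardWeight {l : Fin 2 → ℝ} (h : IsBalanced l)
    (x : figureEight.PathSpace) :
    figureEight.transfer (figureEight.edgeFun (-l)) (figureEight.edgeFun (backwardWeight l)) x =
      figureEight.edgeFun (backwardWeight l) x := by
  have := h.eq
  rw [transfer_edgeFun_edgeFun, UGraph.edgeFun]
  generalize (x.1 0).1 = i
  fin_cases i <;> simp [backwardWeight] <;> linarith

theorem isRPF_markovMeasure {l : Fin 2 → ℝ} (h : IsBalanced l) :
    figureEight.IsRPF (figureEight.edgeFun (-l)) 1 (figureEight.edgeFun (backwardWeight l))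
      (markovMeasure h) where
  beta_pos := one_pos
  cont := continuous_edgeFun _
  pos := fun _ => h.backwardWeight_pos _
  eigen := fun x => by rw [h.transfer_backwardWeight, one_mul]
  prob := inferInstance
  dual := fun f => by
    rw [← integral_dualTransfer l _ f.continuous,
      (isConformal_markovMeasure h).dualTransfer_eq h, one_mul]

theorem exists_prepend (z : figureEight.PathSpace) (e : DirEdge 2) :
    ∃ g : DirEdge 2, z.1 0 ≠ g.bar ∧ g ≠ e.bar := by
  generalize z.1 0 = f
  revert e f
  decide

/-- A nonempty closed set which is invariant under taking preimages of the shift is everything. -/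
theorem eq_univ_of_prepend_mem {A : Set figureEight.PathSpace} (hA : IsClosed A)
    (hne : A.Nonempty) (hpre : ∀ x ∈ A, ∀ e : DirEdge 2, x.1 0 ≠ e.bar → prepend e x ∈ A) :
    A = Set.univ := by
  obtain ⟨x, hx⟩ := hne
  have key : ∀ (n : ℕ) (y : figureEight.PathSpace), ∃ z ∈ A, ∀ i ≤ n, z.1 i = y.1 i := by
    intro n
    induction n with
    | zero =>
      intro y
      obtain ⟨g, hg, hgy⟩ := exists_prepend x (y.1 0)
      have h1 : (prepend g x).1 0 ≠ (y.1 0).bar := by rwa [prepend_zero hg]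
      refine ⟨prepend (y.1 0) (prepend g x), hpre _ (hpre _ hx g hg) _ h1, fun i hi => ?_⟩
      obtain rfl : i = 0 := by omega
      exact prepend_zero h1
    | succ n ih =>
      intro y
      obtain ⟨z, hz, hzy⟩ := ih (figureEight.shift y)
      have h1 : z.1 0 ≠ (y.1 0).bar := by
        rw [hzy 0 (Nat.zero_le _)]
        exact PathSpace.ne_bar y 0
      refine ⟨prepend (y.1 0) z, hpre _ hz _ h1, fun i hi => ?_⟩
      cases i with
      | zero => exact prepend_zero h1
      | succ i =>
        rw [prepend_succ h1, hzy i (by omega)]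
        rfl
  refine Set.eq_univ_of_forall fun y => ?_
  choose z hz hzy using fun n => key n y
  refine hA.mem_of_tendsto (f := z) (b := atTop) ?_ (Eventually.of_forall hz)
  rw [tendsto_subtype_rng, tendsto_pi_nhds]
  intro i
  refine tendsto_const_nhds.congr' ?_
  filter_upwards [eventually_ge_atTop i] with n hn
  exact (hzy n i hn).symm

instance : Nonempty figureEight.PathSpace :=
  ⟨⟨fun _ => (0, true), fun _ => figureEight_adm.2 (by decide : ((0, true) : DirEdge 2) ≠ DirEdge.bar (0, true))⟩⟩

/-- A positive continuous eigenfunction is unique up to scaling. -/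
theorem exists_eq_mul_of_transfer_eq {l : Fin 2 → ℝ} {v w : figureEight.PathSpace → ℝ}
    (hv : Continuous v) (hw : Continuous w) (hpos : ∀ x, 0 < v x) (hwpos : ∀ x, 0 < w x)
    (hLv : ∀ x, figureEight.transfer (figureEight.edgeFun (-l)) v x = v x)
    (hLw : ∀ x, figureEight.transfer (figureEight.edgeFun (-l)) w x = w x) :
    ∃ c > 0, ∀ x, w x = c * v x := by
  have hr : Continuous fun x => w x / v x := hw.div hv fun x => (hpos x).ne'
  obtain ⟨x₀, hx₀⟩ := hr.exists_forall_le_of_hasCompactMulSupport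
    (HasCompactMulSupport.of_compactSpace _)
  set c := w x₀ / v x₀ with hc
  have hle : ∀ x, c * v x ≤ w x := fun x => (le_div_iff₀ (hpos x)).1 (hx₀ x)
  have hA : {x | w x = c * v x} = Set.univ := by
    refine eq_univ_of_prepend_mem (isClosed_eq hw (continuous_const.mul hv))
      ⟨x₀, by rw [mem_ofPred_eq, hc, div_mul_cancel₀ _ (hpos x₀).ne']⟩ fun x hx e he => ?_
    -- Equality at `x` makes a positively weighted sum of the nonnegative differences over the
    -- preimages vanish, so equality passes to every preimage, and preimages are dense.
    have h1 : ∑ e : DirEdge 2 with x.1 0 ≠ e.bar,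
        Real.exp (-l e.1) * (w (prepend e x) - c * v (prepend e x)) = 0 := by
      have h2 := hLw x
      have h3 := hLv x
      rw [transfer_edgeFun] at h2 h3
      simp only [mul_sub, Finset.sum_sub_distrib, h2]
      simp only [mul_left_comm _ c, ← Finset.mul_sum, h3]
      exact sub_eq_zero.2 hx
    rw [Finset.sum_eq_zero_iff_of_nonneg fun e _ =>
      mul_nonneg (Real.exp_pos _).le (sub_nonneg.2 (hle _))] at h1
    have h4 := h1 e (by simpa using he)
    exact sub_eq_zero.1 ((mul_eq_zero.1 h4).resolve_left (Real.exp_pos _).ne')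
  refine ⟨c, div_pos (hwpos x₀) (hpos x₀), fun x => ?_⟩
  have : x ∈ {x | w x = c * v x} := hA ▸ Set.mem_univ x
  exact this

/-- The density of the equilibrium state with respect to the conformal measure. -/
noncomputable def stateDensity {l : Fin 2 → ℝ} (h : IsBalanced l) (x : figureEight.PathSpace) : ℝ :=
  figureEight.edgeFun (backwardWeight l) x /
    ∫ y, figureEight.edgeFun (backwardWeight l) y ∂(markovMeasure h)

/-- The equilibrium state as a Markov measure. -/
noncomputable def markovState {l : Fin 2 → ℝ} (h : IsBalanced l) : Measure figureEight.PathSpace :=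
  (markovMeasure h).withDensity fun x => ENNReal.ofReal (stateDensity h x)

theorem isEquilibriumState_iff {l : Fin 2 → ℝ} (h : IsBalanced l)
    (m : Measure figureEight.PathSpace) :
    figureEight.IsEquilibriumState (figureEight.edgeFun (-l)) m ↔ m = markovState h := by
  constructor
  · rintro ⟨v, μ, hv, rfl⟩
    have := hv.prob
    have hμ : μ = markovMeasure h :=
      (h.isConformal_of_dual fun f => by rw [hv.dual, one_mul]).unique (isConformal_markovMeasure h)
    obtain ⟨c, hc, hcv⟩ := exists_eq_mul_of_transfer_eq (continuous_edgeFun (backwardWeight l))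
      hv.cont (fun x => h.backwardWeight_pos _) hv.pos h.transfer_backwardWeight
      (fun x => by rw [hv.eigen, one_mul])
    simp only [hcv, hμ, markovState, stateDensity, integral_const_mul, mul_div_mul_left _ _ hc.ne']
  · rintro rfl
    exact ⟨_, _, isRPF_markovMeasure h, rfl⟩

theorem existsUnique_isEquilibriumState {l : Fin 2 → ℝ} (h : IsBalanced l) :
    ∃! m, figureEight.IsEquilibriumState (figureEight.edgeFun (-l)) m :=
  ⟨markovState h, (isEquilibriumState_iff h _).2 rfl, fun _ hm => (isEquilibriumState_iff h _).1 hm⟩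

theorem state_eq {l : Fin 2 → ℝ} (h : IsBalanced l) : figureEight.state l = markovState h := by
  have hex := (existsUnique_isEquilibriumState h).exists
  rw [UGraph.state, UGraph.equilibriumState, dif_pos hex]
  exact (isEquilibriumState_iff h _).1 hex.choose_spec

theorem integral_backwardWeight_pos {l : Fin 2 → ℝ} (h : IsBalanced l) :
    0 < ∫ y, figureEight.edgeFun (backwardWeight l) y ∂(markovMeasure h) := by
  rw [integral_pos_iff_support_of_nonneg (f := figureEight.edgeFun (backwardWeight l))
    (fun x => (h.backwardWeight_pos _).le)
    (integrable_of_continuous (continuous_edgeFun _))]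
  have : Function.support (figureEight.edgeFun (backwardWeight l)) = Set.univ :=
    Set.eq_univ_of_forall fun x => (h.backwardWeight_pos _).ne'
  rw [this, measure_univ]
  exact one_pos

theorem continuous_stateDensity {l : Fin 2 → ℝ} (h : IsBalanced l) :
    Continuous (stateDensity h) :=
  (continuous_edgeFun _).div_const _

theorem stateDensity_pos {l : Fin 2 → ℝ} (h : IsBalanced l) (x : figureEight.PathSpace) :
    0 < stateDensity h x :=
  div_pos (h.backwardWeight_pos _) (integral_backwardWeight_pos h)

theorem integral_markovState {l : Fin 2 → ℝ} (h : IsBalanced l) (f : figureEight.PathSpace → ℝ) :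
    ∫ x, f x ∂(markovState h) = ∫ x, stateDensity h x * f x ∂(markovMeasure h) := by
  rw [markovState, integral_withDensity_eq_integral_toReal_smul
    (continuous_stateDensity h).measurable.ennreal_ofReal (ae_of_all _ fun x =>
      ENNReal.ofReal_lt_top)]
  simp only [ENNReal.toReal_ofReal (stateDensity_pos h _).le, smul_eq_mul]

instance {l : Fin 2 → ℝ} (h : IsBalanced l) : IsProbabilityMeasure (markovState h) := by
  constructor
  rw [markovState, withDensity_apply _ MeasurableSet.univ, Measure.restrict_univ,
    ← ofReal_integral_eq_lintegral_ofReal (integrable_of_continuous (continuous_stateDensity h))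
      (ae_of_all _ fun x => (stateDensity_pos h x).le)]
  simp only [stateDensity, integral_div]
  rw [div_self (integral_backwardWeight_pos h).ne', ENNReal.ofReal_one]

/-- If `φ` is an eigenfunction of the normalised transfer operator, then `∫ φ (f ∘ σ)` is the
eigenvalue times `∫ φ f`. -/
theorem integral_mul_comp_shift {l : Fin 2 → ℝ} (h : IsBalanced l) {φ : Fin 2 → ℝ} {c : ℝ}
    (hφ : ∀ x, figureEight.transfer (figureEight.edgeFun (-l))
      (figureEight.edgeFun (backwardWeight l * φ)) x =
        c * figureEight.edgeFun (backwardWeight l * φ) x)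
    {f : figureEight.PathSpace → ℝ} (hf : Continuous f) :
    ∫ x, figureEight.edgeFun φ x * f (figureEight.shift x) ∂(markovState h) =
      c * ∫ x, figureEight.edgeFun φ x * f x ∂(markovState h) := by
  rw [integral_markovState, integral_markovState]
  set Z := ∫ y, figureEight.edgeFun (backwardWeight l) y ∂(markovMeasure h) with hZ
  have h1 : ∀ g : figureEight.PathSpace → ℝ, ∀ x,
      stateDensity h x * (figureEight.edgeFun φ x * g x) =
        Z⁻¹ * (figureEight.edgeFun (backwardWeight l * φ) x * g x) := by
    intro g x
    have h3 : figureEight.edgeFun (backwardWeight l * φ) x =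
        figureEight.edgeFun (backwardWeight l) x * figureEight.edgeFun φ x := rfl
    rw [stateDensity, ← hZ, h3]
    ring
  rw [integral_congr_ae (ae_of_all _ (h1 fun x => f (figureEight.shift x))),
    integral_congr_ae (ae_of_all _ (h1 f)), integral_const_mul, integral_const_mul]
  have h2 := (isRPF_markovMeasure h).dual
    ⟨fun x => figureEight.edgeFun (backwardWeight l * φ) x * f (figureEight.shift x),
      (continuous_edgeFun _).mul (hf.comp continuous_shift)⟩
  simp only [ContinuousMap.coe_mk, one_mul] at h2
  rw [← h2]
  simp only [transfer_mul_comp_shift, hφ, mul_assoc]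
  rw [integral_const_mul]
  ring

theorem integral_comp_shift {l : Fin 2 → ℝ} (h : IsBalanced l)
    {f : figureEight.PathSpace → ℝ} (hf : Continuous f) :
    ∫ x, f (figureEight.shift x) ∂(markovState h) = ∫ x, f x ∂(markovState h) := by
  have := integral_mul_comp_shift h (φ := 1) (c := 1)
    (by simpa using h.transfer_backwardWeight) hf
  simpa [UGraph.edgeFun] using this

/-! ### The variance -/

/-- The second eigenvalue of the normalised transfer operator. -/
noncomputable def secondEigenvalue (l : Fin 2 → ℝ) : ℝ := Real.exp (-l 0) + Real.exp (-l 1) - 1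

/-- On functions of the first loop the operator is a 2 × 2 matrix of trace `a + b` with eigenvalue
1, so the other eigenvalue is `a + b - 1`. The linear condition on `φ` describes its eigenline. -/
theorem IsBalanced.transfer_mul {l : Fin 2 → ℝ} (h : IsBalanced l) {φ : Fin 2 → ℝ}
    (hφ : (1 - Real.exp (-l 1)) * φ 0 + (1 - Real.exp (-l 0)) * φ 1 = 0)
    (x : figureEight.PathSpace) :
    figureEight.transfer (figureEight.edgeFun (-l)) (figureEight.edgeFun (backwardWeight l * φ)) x =
      secondEigenvalue l * figureEight.edgeFun (backwardWeight l * φ) x := by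
  have := h.eq
  rw [transfer_edgeFun_edgeFun, UGraph.edgeFun]
  generalize (x.1 0).1 = i
  fin_cases i <;> simp [backwardWeight, secondEigenvalue]
  · linear_combination (2 * Real.exp (-l 1)) * hφ
  · linear_combination (1 - Real.exp (-l 0)) * hφ - φ 0 * this

theorem IsBalanced.abs_secondEigenvalue_lt_one {l : Fin 2 → ℝ} (h : IsBalanced l) :
    |secondEigenvalue l| < 1 := by
  have h0 := h.exp_lt_one 0
  have h1 := h.exp_lt_one 1
  have h2 := Real.exp_pos (-l 0)
  have h3 := Real.exp_pos (-l 1)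
  rw [abs_lt, secondEigenvalue]
  constructor <;> linarith

theorem IsBalanced.integral_edgeFun {l : Fin 2 → ℝ} (h : IsBalanced l) (φ : Fin 2 → ℝ) :
    (2 - Real.exp (-l 0) - Real.exp (-l 1)) * ∫ x, figureEight.edgeFun φ x ∂(markovState h) =
      (1 - Real.exp (-l 1)) * φ 0 + (1 - Real.exp (-l 0)) * φ 1 := by
  -- An eigenfunction for an eigenvalue different from 1 has mean zero, by the correlation identity
  -- with `f = 1`.
  have hmean : ∫ x, figureEight.edgeFun ![1 - Real.exp (-l 0), -(1 - Real.exp (-l 1))] x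
      ∂(markovState h) = 0 := by
    have h1 := integral_mul_comp_shift h
      (φ := ![1 - Real.exp (-l 0), -(1 - Real.exp (-l 1))])
      (h.transfer_mul (by simp; ring)) (f := fun _ => 1) continuous_const
    have h2 := h.abs_secondEigenvalue_lt_one
    simp only [mul_one] at h1
    rw [abs_lt] at h2
    generalize ∫ x, figureEight.edgeFun ![1 - Real.exp (-l 0), -(1 - Real.exp (-l 1))] x
      ∂(markovState h) = I at *
    have h3 : (1 - secondEigenvalue l) * I = 0 := by linear_combination h1
    exact (mul_eq_zero.1 h3).resolve_left (by linarith)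
  -- Up to the normalising factor, every edge function is a constant plus a multiple of that
  -- mean-zero eigenvector.
  have hdec : ∀ x, (2 - Real.exp (-l 0) - Real.exp (-l 1)) * figureEight.edgeFun φ x =
      ((1 - Real.exp (-l 1)) * φ 0 + (1 - Real.exp (-l 0)) * φ 1) + (φ 0 - φ 1) *
        figureEight.edgeFun ![1 - Real.exp (-l 0), -(1 - Real.exp (-l 1))] x := by
    intro x
    simp only [UGraph.edgeFun]
    generalize (x.1 0).1 = i
    fin_cases i <;> simp <;> ring
  rw [← integral_const_mul, integral_congr_ae (ae_of_all _ hdec), integral_add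
    (integrable_const _) ((integrable_of_continuous (continuous_edgeFun _)).const_mul _),
    integral_const_mul, hmean]
  simp

theorem isTangent_iff {l : Fin 2 → ℝ} (h : IsBalanced l) (φ : Fin 2 → ℝ) :
    figureEight.IsTangent l φ ↔
      (1 - Real.exp (-l 1)) * φ 0 + (1 - Real.exp (-l 0)) * φ 1 = 0 := by
  have h0 := h.exp_lt_one 0
  have h1 := h.exp_lt_one 1
  rw [← h.integral_edgeFun, UGraph.IsTangent, state_eq h, mul_eq_zero]
  constructor
  · exact Or.inr
  · rintro (h2 | h2)
    · linarith
    · exact h2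

theorem continuous_birkhoffSum (φ : Fin 2 → ℝ) (n : ℕ) :
    Continuous (birkhoffSum figureEight.shift (figureEight.edgeFun φ) n) := by
  change Continuous fun x => birkhoffSum figureEight.shift (figureEight.edgeFun φ) n x
  simp only [birkhoffSum]
  exact continuous_finsetSum _ fun i _ =>
    (continuous_edgeFun φ).comp (continuous_shift.iterate i)

/-- The solution of `q (n + 1) = V + c * q n`. -/
theorem tendsto_affine_recursion {V c : ℝ} (hc : |c| < 1) {q : ℕ → ℝ} (h0 : q 0 = 0)
    (hq : ∀ n, q (n + 1) = V + c * q n) : Tendsto q atTop (𝓝 (V / (1 - c))) := by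
  have hc1 : 1 - c ≠ 0 := by
    have := (abs_lt.1 hc).2
    linarith
  have h : ∀ n, q n = V / (1 - c) * (1 - c ^ n) := by
    intro n
    induction n with
    | zero => simp [h0]
    | succ n ih =>
      rw [hq, ih]
      field_simp
      ring
  rw [show q = fun n => V / (1 - c) * (1 - c ^ n) from funext h]
  simpa using ((tendsto_pow_atTop_nhds_zero_of_abs_lt_one hc).const_sub 1).const_mul (V / (1 - c))

/-- Splitting `S (n + 1) = φ + S n ∘ σ` gives an affine recursion of ratio `c` for `q n = ∫ φ * S
n`. The increments of `∫ (S n)²` are `V + 2 * c * q n`, so they converge, and the variance is their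
Cesàro limit. -/
theorem tendsto_varianceSeq {l : Fin 2 → ℝ} (h : IsBalanced l) {φ : Fin 2 → ℝ}
    (hφ : figureEight.IsTangent l φ) :
    Tendsto (figureEight.varianceSeq (figureEight.edgeFun φ) (figureEight.state l)) atTop
      (𝓝 ((∫ x, figureEight.edgeFun φ x ^ 2 ∂(markovState h)) *
        (1 + secondEigenvalue l) / (1 - secondEigenvalue l))) := by
  set c := secondEigenvalue l with hc
  set V := ∫ x, figureEight.edgeFun φ x ^ 2 ∂(markovState h) with hV
  set S := birkhoffSum figureEight.shift (figureEight.edgeFun φ) with hS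
  have hcont := continuous_edgeFun φ
  have hScont : ∀ n, Continuous (S n) := continuous_birkhoffSum φ
  have hLφ := h.transfer_mul ((isTangent_iff h φ).1 hφ)
  set q : ℕ → ℝ := fun n => ∫ x, figureEight.edgeFun φ x * S n x ∂(markovState h) with hq
  set r : ℕ → ℝ := fun n => ∫ x, S n x ^ 2 ∂(markovState h) with hr
  have hstep : ∀ n, ∫ x, figureEight.edgeFun φ x * S n (figureEight.shift x) ∂(markovState h) =
      c * q n := fun n => integral_mul_comp_shift h hLφ (hScont n)
  have hqrec : ∀ n, q (n + 1) = V + c * q n := by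
    intro n
    rw [← hstep n, hV, ← integral_add]
    · refine integral_congr_ae (ae_of_all _ fun x => ?_)
      simp only [hS, birkhoffSum_succ']
      ring
    · exact integrable_of_continuous (hcont.pow 2)
    · exact integrable_of_continuous (hcont.mul ((hScont n).comp continuous_shift))
  have hrrec : ∀ n, r (n + 1) = r n + (V + 2 * c * q n) := by
    intro n
    have h1 : r n = ∫ x, S n (figureEight.shift x) ^ 2 ∂(markovState h) :=
      (integral_comp_shift h (f := fun x => S n x ^ 2) ((hScont n).pow 2)).symm
    rw [mul_assoc, ← hstep n, h1, hV, ← integral_const_mul, ← integral_add, ← integral_add]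
    · refine integral_congr_ae (ae_of_all _ fun x => ?_)
      simp only [hS, birkhoffSum_succ']
      ring
    · exact integrable_of_continuous (((hScont n).comp continuous_shift).pow 2)
    · exact integrable_of_continuous ((hcont.pow 2).add
        (continuous_const.mul (hcont.mul ((hScont n).comp continuous_shift))))
    · exact integrable_of_continuous (hcont.pow 2)
    · exact integrable_of_continuous
        (continuous_const.mul (hcont.mul ((hScont n).comp continuous_shift)))
  have hrsum : ∀ n, r n = ∑ i ∈ Finset.range n, (V + 2 * c * q i) := by
    intro n
    induction n with
    | zero => simp [hr, hS]
    | succ n ih => rw [hrrec, Finset.sum_range_succ, ih]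
  have hqlim : Tendsto q atTop (𝓝 (V / (1 - c))) :=
    tendsto_affine_recursion h.abs_secondEigenvalue_lt_one (by simp [hq, hS]) hqrec
  have hlim := ((hqlim.const_mul (2 * c)).const_add V).cesaro
  have hc1 : 1 - c ≠ 0 := by
    have := (abs_lt.1 h.abs_secondEigenvalue_lt_one).2
    rw [← hc] at this
    linarith
  have heq : V + 2 * c * (V / (1 - c)) = V * (1 + c) / (1 - c) := by
    field_simp
    ring
  rw [heq] at hlim
  refine hlim.congr fun n => ?_
  have hmean : ∫ y, figureEight.edgeFun φ y ∂(markovState h) = 0 := by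
    rw [← state_eq h]
    exact hφ
  rw [← hrsum, UGraph.varianceSeq, state_eq h, hmean]
  simp [hr, hS]

theorem pressureNorm_sq {l : Fin 2 → ℝ} (h : IsBalanced l) {φ : Fin 2 → ℝ}
    (hφ : figureEight.IsTangent l φ) :
    figureEight.pressureNorm l φ ^ 2 = φ 0 ^ 2 * ((1 - Real.exp (-l 1)) *
      (Real.exp (-l 0) + Real.exp (-l 1)) /
        ((2 - Real.exp (-l 0) - Real.exp (-l 1)) * (1 - Real.exp (-l 0)))) := by
  have h0 := h.exp_lt_one 0
  have h1 := h.exp_lt_one 1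
  have h2 := Real.exp_pos (-l 0)
  have h3 := Real.exp_pos (-l 1)
  have htan := (isTangent_iff h φ).1 hφ
  have hint := h.integral_edgeFun (φ ^ 2)
  have hval : figureEight.dynVariance (figureEight.edgeFun φ) (figureEight.state l) =
      φ 0 ^ 2 * ((1 - Real.exp (-l 1)) * (Real.exp (-l 0) + Real.exp (-l 1)) /
        ((2 - Real.exp (-l 0) - Real.exp (-l 1)) * (1 - Real.exp (-l 0)))) := by
    rw [UGraph.dynVariance, (tendsto_varianceSeq h hφ).limUnder_eq, secondEigenvalue]
    have hsq : ∀ x, figureEight.edgeFun φ x ^ 2 = figureEight.edgeFun (φ ^ 2) x := fun x => rfl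
    simp only [hsq]
    generalize ∫ x, figureEight.edgeFun (φ ^ 2) x ∂(markovState h) = V at *
    simp only [Pi.pow_apply] at hint
    generalize Real.exp (-l 0) = a at *
    generalize Real.exp (-l 1) = b at *
    have ha : 1 - a ≠ 0 := by linarith
    have hab : 2 - a - b ≠ 0 := by linarith
    -- Tangency eliminates `φ 1` from the second moment.
    have hV : V * (1 - a) = (1 - b) * φ 0 ^ 2 := by
      apply mul_left_cancel₀ hab
      linear_combination (1 - a) * hint + ((1 - a) * φ 1 - (1 - b) * φ 0) * htan
    have hab' : 1 - (a + b - 1) ≠ 0 := by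
      intro h; apply hab; linarith
    rw [div_eq_iff hab']
    field_simp
    linear_combination (a + b) * (2 - a - b) * hV
  rw [UGraph.pressureNorm, hval, Real.sq_sqrt]
  have h4 : 0 < 2 - Real.exp (-l 0) - Real.exp (-l 1) := by linarith
  have h5 : 0 < 1 - Real.exp (-l 0) := by linarith
  have h6 : 0 < 1 - Real.exp (-l 1) := by linarith
  positivity

/-! ### The speed of the curve of entropy-one weightings -/

theorem exp_neg_lt_one {x : ℝ} (hx : 0 < x) : Real.exp (-x) < 1 := by
  rw [Real.exp_lt_one_iff]
  linarith

theorem contDiffOn_eightCurve : ContDiffOn ℝ ∞ eightCurve (Ioi 0) := by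
  rw [contDiffOn_pi]
  intro i
  fin_cases i
  · exact contDiffOn_id
  · refine ContDiffOn.neg (ContDiffOn.log (ContDiffOn.div (by fun_prop) (by fun_prop) ?_) ?_)
    · intro x _
      positivity
    · intro x hx
      have h1 := exp_neg_lt_one hx
      exact (div_pos (by linarith) (by positivity)).ne'

theorem hasDerivAt_eightCurve {x : ℝ} (hx : 0 < x) :
    HasDerivAt eightCurve
      ![1, -(4 * Real.exp (-x) / ((1 - Real.exp (-x)) * (1 + 3 * Real.exp (-x))))] x := by
  have h1 := exp_neg_lt_one hx
  have h0 := Real.exp_pos (-x)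
  have h2 : 1 - Real.exp (-x) ≠ 0 := by linarith
  have h3 : 1 + 3 * Real.exp (-x) ≠ 0 := by positivity
  have hexp : HasDerivAt (fun y : ℝ => Real.exp (-y)) (-Real.exp (-x)) x := by
    simpa using (hasDerivAt_neg x).exp
  rw [hasDerivAt_pi]
  intro i
  fin_cases i
  · exact hasDerivAt_id x
  · have h4 := (((hexp.const_sub 1).div ((hexp.const_mul 3).const_add 1) h3).log
      (div_ne_zero h2 h3)).neg
    refine h4.congr_deriv ?_
    simp only [Fin.mk_one, Matrix.cons_val_one, Matrix.cons_val_fin_one, Pi.div_apply]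
    field_simp
    ring

theorem deriv_eightCurve_zero {x : ℝ} (hx : 0 < x) : deriv eightCurve x 0 = 1 := by
  rw [(hasDerivAt_eightCurve hx).deriv]
  rfl

theorem exp_neg_eightCurve_one {x : ℝ} (hx : 0 < x) :
    Real.exp (-eightCurve x 1) = (1 - Real.exp (-x)) / (1 + 3 * Real.exp (-x)) := by
  have h1 := exp_neg_lt_one hx
  simp only [eightCurve, Matrix.cons_val_one, Matrix.cons_val_fin_one, neg_neg]
  exact Real.exp_log (div_pos (by linarith) (by positivity))

theorem isTangent_deriv_eightCurve {x : ℝ} (hx : 0 < x) :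
    figureEight.IsTangent (eightCurve x) (deriv eightCurve x) := by
  have h1 := exp_neg_lt_one hx
  have h0 := Real.exp_pos (-x)
  have h2 : 1 - Real.exp (-x) ≠ 0 := by linarith
  rw [isTangent_iff (isBalanced_eightCurve hx), exp_neg_eightCurve_one hx,
    (hasDerivAt_eightCurve hx).deriv]
  simp only [eightCurve, Matrix.cons_val_zero, Matrix.cons_val_one, Matrix.cons_val_fin_one]
  field_simp
  ring

/-- The square of the speed of the curve `eightCurve`. -/
noncomputable def eightSpeedSq (x : ℝ) : ℝ :=
  4 * Real.exp x * (Real.exp (2 * x) + 3) /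
    (Real.exp (4 * x) + 8 * Real.exp (3 * x) + 6 * Real.exp (2 * x) - 24 * Real.exp x + 9)

/-- The speed of the curve `eightCurve`. -/
noncomputable def eightSpeed (x : ℝ) : ℝ := √(eightSpeedSq x)

/-- The quartic in `E = exp x` factors as `(E - 1)(E + 3)(E² + 6E - 3)`. Its simple zero at `E = 1`
is the only source of the singularity `1 / x` at the origin. -/
theorem eightSpeedSq_eq (x : ℝ) : eightSpeedSq x =
    4 * Real.exp x * (Real.exp x ^ 2 + 3) /
      ((Real.exp x ^ 2 + 6 * Real.exp x - 3) * (Real.exp x + 3)) / (Real.exp x - 1) := by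
  have h2 : Real.exp (2 * x) = Real.exp x ^ 2 := by rw [← Real.exp_nat_mul]; norm_num
  have h3 : Real.exp (3 * x) = Real.exp x ^ 3 := by rw [← Real.exp_nat_mul]; norm_num
  have h4 : Real.exp (4 * x) = Real.exp x ^ 4 := by rw [← Real.exp_nat_mul]; norm_num
  rw [eightSpeedSq, h2, h3, h4, div_div]
  congr 1
  ring

theorem eightSpeedSq_pos {x : ℝ} (hx : 0 < x) : 0 < eightSpeedSq x := by
  have h1 : 1 < Real.exp x := Real.one_lt_exp_iff.2 hx
  rw [eightSpeedSq_eq]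
  have h2 : 0 < Real.exp x - 1 := by linarith
  have h3 : 0 < Real.exp x ^ 2 + 6 * Real.exp x - 3 := by nlinarith
  positivity

theorem eightSpeed_pos {x : ℝ} (hx : 0 < x) : 0 < eightSpeed x :=
  Real.sqrt_pos.2 (eightSpeedSq_pos hx)

theorem pressureNorm_smul_sq {x : ℝ} (hx : 0 < x) (s : ℝ) :
    figureEight.pressureNorm (eightCurve x) (s • deriv eightCurve x) ^ 2 =
      s ^ 2 * eightSpeedSq x := by
  have hb := isBalanced_eightCurve hx
  have htan := (isTangent_iff hb _).1 (isTangent_deriv_eightCurve hx)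
  have hE : 1 < Real.exp x := Real.one_lt_exp_iff.2 hx
  rw [pressureNorm_sq hb ((isTangent_iff hb _).2 (by
    simp only [Pi.smul_apply, smul_eq_mul]
    linear_combination s * htan)), exp_neg_eightCurve_one hx, eightSpeedSq_eq, Pi.smul_apply,
    deriv_eightCurve_zero hx, smul_eq_mul, mul_one]
  congr 1
  simp only [eightCurve, Matrix.cons_val_zero, Real.exp_neg]
  generalize Real.exp x = E at *
  have hE0 : 0 < E := by linarith
  have h1 : E - 1 ≠ 0 := by linarith
  have h2 : E ^ 2 + 6 * E - 3 ≠ 0 := by nlinarith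
  have h3 : E + 3 ≠ 0 := by linarith
  have e1 : (1 - E⁻¹) / (1 + 3 * E⁻¹) = (E - 1) / (E + 3) := by field_simp
  have e2 : 1 - (E - 1) / (E + 3) = 4 / (E + 3) := by field_simp; ring
  have e3 : E⁻¹ + (E - 1) / (E + 3) = (E ^ 2 + 3) / (E * (E + 3)) := by field_simp; ring
  have e4 : 2 - E⁻¹ - (E - 1) / (E + 3) = (E ^ 2 + 6 * E - 3) / (E * (E + 3)) := by
    field_simp; ring
  have e5 : 1 - E⁻¹ = (E - 1) / E := by field_simp
  rw [e1, e2, e3, e4, e5]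
  field_simp

theorem pressureNorm_smul {x : ℝ} (hx : 0 < x) (s : ℝ) :
    figureEight.pressureNorm (eightCurve x) (s • deriv eightCurve x) = |s| * eightSpeed x := by
  have h1 : 0 ≤ figureEight.pressureNorm (eightCurve x) (s • deriv eightCurve x) :=
    Real.sqrt_nonneg _
  rw [← Real.sqrt_sq h1, pressureNorm_smul_sq hx, Real.sqrt_mul (sq_nonneg s), Real.sqrt_sq_eq_abs,
    eightSpeed]

theorem pressureNorm_deriv_eightCurve {x : ℝ} (hx : 0 < x) :
    figureEight.pressureNorm (eightCurve x) (deriv eightCurve x) = eightSpeed x := by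
  simpa using pressureNorm_smul hx 1

theorem pressureNorm_deriv_eightCurve_sq {x : ℝ} (hx : 0 < x) :
    figureEight.pressureNorm (eightCurve x) (deriv eightCurve x) ^ 2 = eightSpeedSq x := by
  simpa using pressureNorm_smul_sq hx 1

theorem isEquivalent_eightSpeedSq :
    Asymptotics.IsEquivalent (𝓝[>] (0 : ℝ)) eightSpeedSq fun x => 1 / x := by
  rw [Asymptotics.isEquivalent_iff_tendsto_one]
  · have hslope : Tendsto (fun x : ℝ => x⁻¹ * (Real.exp x - 1)) (𝓝[>] 0) (𝓝 1) := by
      have := (Real.hasDerivAt_exp 0).tendsto_slope_zero_right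
      simpa using this
    have hinv : Tendsto (fun x : ℝ => (x⁻¹ * (Real.exp x - 1))⁻¹) (𝓝[>] 0) (𝓝 1) := by
      simpa using hslope.inv₀ one_ne_zero
    have hfac : Tendsto (fun x : ℝ => 4 * Real.exp x * (Real.exp x ^ 2 + 3) /
        ((Real.exp x ^ 2 + 6 * Real.exp x - 3) * (Real.exp x + 3))) (𝓝[>] 0) (𝓝 1) := by
      have hc : ContinuousAt (fun x : ℝ => 4 * Real.exp x * (Real.exp x ^ 2 + 3) /
          ((Real.exp x ^ 2 + 6 * Real.exp x - 3) * (Real.exp x + 3))) 0 := by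
        refine ContinuousAt.div (by fun_prop) (by fun_prop) ?_
        norm_num
      have := hc.tendsto
      norm_num at this
      exact this.mono_left nhdsWithin_le_nhds
    have := hfac.mul hinv
    rw [one_mul] at this
    refine this.congr' ?_
    filter_upwards [self_mem_nhdsWithin] with x hx
    rw [Pi.div_apply, eightSpeedSq_eq]
    simp only [mul_inv, inv_inv, one_div, div_inv_eq_mul]
    ring
  · filter_upwards [self_mem_nhdsWithin] with x hx
    exact one_div_ne_zero (ne_of_gt hx)

theorem continuousOn_eightSpeed : ContinuousOn eightSpeed (Ioi 0) := by
  refine ContinuousOn.sqrt ?_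
  intro x hx
  have h := eightSpeedSq_pos hx
  refine ContinuousAt.continuousWithinAt (ContinuousAt.div (by fun_prop) (by fun_prop) fun h0 => ?_)
  rw [eightSpeedSq, h0, div_zero] at h
  exact lt_irrefl _ h

theorem measurable_eightSpeed : Measurable eightSpeed := by
  unfold eightSpeed eightSpeedSq
  fun_prop

/-- The regular factor of the squared speed is at most 4 and `exp x - 1 ≥ x`. The resulting bound is
integrable at 0. -/
theorem eightSpeed_le {x : ℝ} (hx : 0 < x) : eightSpeed x ≤ 2 * x ^ (-(1 / 2) : ℝ) := by
  have hE : x + 1 ≤ Real.exp x := Real.add_one_le_exp x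
  have h1 : eightSpeedSq x ≤ 4 / x := by
    rw [eightSpeedSq_eq]
    generalize Real.exp x = E at *
    have h2 : 0 < E ^ 2 + 6 * E - 3 := by nlinarith
    have h3 : 0 < E + 3 := by linarith
    have h4 : 4 * E * (E ^ 2 + 3) / ((E ^ 2 + 6 * E - 3) * (E + 3)) ≤ 4 := by
      rw [div_le_iff₀ (by positivity)]
      nlinarith
    calc _ ≤ 4 / (E - 1) := by
          apply div_le_div_of_nonneg_right h4
          linarith
      _ ≤ 4 / x := by
          apply div_le_div_of_nonneg_left (by norm_num) hx
          linarith
  calc eightSpeed x ≤ √(4 / x) := Real.sqrt_le_sqrt h1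
    _ = 2 * x ^ (-(1 / 2) : ℝ) := by
      rw [Real.sqrt_div (by norm_num), show (4 : ℝ) = 2 ^ 2 by norm_num,
        Real.sqrt_sq (by norm_num), Real.rpow_neg hx.le, ← Real.sqrt_eq_rpow, div_eq_mul_inv]

theorem intervalIntegrable_eightSpeed {x : ℝ} (hx : 0 < x) :
    IntervalIntegrable eightSpeed volume 0 x := by
  have h := (intervalIntegral.intervalIntegrable_rpow' (a := 0) (b := x)
    (r := (-(1 / 2) : ℝ)) (by norm_num)).const_mul 2
  refine h.mono_fun measurable_eightSpeed.aestronglyMeasurable ?_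
  filter_upwards [ae_restrict_mem measurableSet_uIoc] with y hy
  rw [uIoc_of_le hx.le] at hy
  rw [Real.norm_of_nonneg (eightSpeed_pos hy.1).le]
  exact (eightSpeed_le hy.1).trans (le_abs_self _)

theorem lintegral_pressureNorm_lt_top :
    (∫⁻ x in Ioc (0 : ℝ) 1,
      ENNReal.ofReal (figureEight.pressureNorm (eightCurve x) (deriv eightCurve x))) < ⊤ := by
  rw [setLIntegral_congr_fun measurableSet_Ioc fun x hx => by
    rw [pressureNorm_deriv_eightCurve hx.1]]
  have h := (intervalIntegrable_iff_integrableOn_Ioc_of_le zero_le_one).1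
    (intervalIntegrable_eightSpeed one_pos)
  exact h.lintegral_lt_top

/-! ### The path distance -/

/-- The length of `eightCurve` from `0` to `x`. -/
noncomputable def arcLength (x : ℝ) : ℝ := ∫ t in (0 : ℝ)..x, eightSpeed t

theorem hasDerivAt_arcLength {x : ℝ} (hx : 0 < x) : HasDerivAt arcLength (eightSpeed x) x :=
  intervalIntegral.integral_hasDerivAt_right (intervalIntegrable_eightSpeed hx)
    measurable_eightSpeed.stronglyMeasurable.stronglyMeasurableAtFilter
    (continuousOn_eightSpeed.continuousAt (Ioi_mem_nhds hx))

theorem arcLength_pos {x : ℝ} (hx : 0 < x) : 0 < arcLength x :=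
  intervalIntegral.intervalIntegral_pos_of_pos_on (intervalIntegrable_eightSpeed hx)
    (fun _ hy => eightSpeed_pos hy.1) hx

theorem strictMonoOn_arcLength : StrictMonoOn arcLength (Ioi 0) := by
  refine strictMonoOn_of_deriv_pos (convex_Ioi 0)
    (fun x hx => (hasDerivAt_arcLength hx).continuousAt.continuousWithinAt) fun x hx => ?_
  rw [interior_Ioi] at hx
  rw [(hasDerivAt_arcLength hx).deriv]
  exact eightSpeed_pos hx

theorem tendsto_arcLength : Tendsto arcLength (𝓝[>] 0) (𝓝 0) := by
  have h := intervalIntegral.continuousOn_primitive_interval'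
    (intervalIntegrable_eightSpeed one_pos) left_mem_uIcc
  have h0 := h 0 left_mem_uIcc
  rw [ContinuousWithinAt, intervalIntegral.integral_same, uIcc_of_le zero_le_one] at h0
  refine h0.mono_left ?_
  rw [← nhdsWithin_Ioo_eq_nhdsGT (zero_lt_one' ℝ)]
  exact nhdsWithin_mono _ Ioo_subset_Icc_self

theorem apply_zero_pos {l : Fin 2 → ℝ} (hl : l ∈ figureEight.entropyOne) : 0 < l 0 := hl.1 0

/-- The length of a curve is the total variation of the arc length along it. -/
theorem pressureLength_eq {p q : Fin 2 → ℝ} {γ : ℝ → Fin 2 → ℝ} (hγ : figureEight.IsCurve p q γ) :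
    figureEight.pressureLength γ = ENNReal.ofReal (∫ t in (0 : ℝ)..1,
      |eightSpeed (γ t 0) * derivWithin (fun t => γ t 0) (Icc 0 1) t|) ∧
    ∫ t in (0 : ℝ)..1, eightSpeed (γ t 0) * derivWithin (fun t => γ t 0) (Icc 0 1) t =
      arcLength (q 0) - arcLength (p 0) := by
  set x : ℝ → ℝ := fun t => γ t 0 with hxdef
  have hx : ContDiffOn ℝ 1 x (Icc 0 1) := (contDiffOn_pi.1 hγ.contDiffOn) 0
  have hpos : ∀ t ∈ Icc (0 : ℝ) 1, 0 < x t := fun t ht => apply_zero_pos (hγ.mem t ht)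
  have hud := uniqueDiffOn_Icc (zero_lt_one' ℝ)
  have hxd : ∀ t ∈ Icc (0 : ℝ) 1, HasDerivWithinAt x (derivWithin x (Icc 0 1) t) (Icc 0 1) t :=
    fun t ht => (hx.differentiableOn one_ne_zero t ht).hasDerivWithinAt
  have hγx : ∀ t ∈ Icc (0 : ℝ) 1, γ t = eightCurve (x t) := fun t ht =>
    (mem_entropyOne_iff.1 (hγ.mem t ht)).eq_eightCurve
  have hγd : ∀ t ∈ Icc (0 : ℝ) 1, derivWithin γ (Icc 0 1) t =
      derivWithin x (Icc 0 1) t • deriv eightCurve (x t) := by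
    intro t ht
    have h1 := (hasDerivAt_eightCurve (hpos t ht)).differentiableAt.hasDerivAt
    have h2 := h1.scomp_hasDerivWithinAt t (hxd t ht)
    exact (h2.congr hγx (hγx t ht)).derivWithin (hud t ht)
  have hcont : ContinuousOn (fun t => eightSpeed (x t) * derivWithin x (Icc 0 1) t) (Icc 0 1) :=
    (continuousOn_eightSpeed.comp hx.continuousOn hpos).mul
      (hx.continuousOn_derivWithin hud le_rfl)
  have hint : IntervalIntegrable (fun t => eightSpeed (x t) * derivWithin x (Icc 0 1) t)
      volume 0 1 := by
    apply ContinuousOn.intervalIntegrable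
    rwa [uIcc_of_le zero_le_one]
  constructor
  · rw [UGraph.pressureLength, setLIntegral_congr_fun measurableSet_Icc fun t ht => by
      rw [hγd t ht, hγx t ht, pressureNorm_smul (hpos t ht), mul_comm,
        ← abs_of_pos (eightSpeed_pos (hpos t ht)), ← abs_mul],
      intervalIntegral.integral_of_le zero_le_one, ← integral_Icc_eq_integral_Ioc,
      ofReal_integral_eq_lintegral_ofReal]
    · exact (hcont.abs.integrableOn_Icc)
    · exact ae_of_all _ fun t => abs_nonneg _
  · have hd : ∀ t ∈ Icc (0 : ℝ) 1, HasDerivWithinAt (fun t => arcLength (x t))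
        (eightSpeed (x t) * derivWithin x (Icc 0 1) t) (Icc 0 1) t := fun t ht =>
      (hasDerivAt_arcLength (hpos t ht)).comp_hasDerivWithinAt t (hxd t ht)
    rw [intervalIntegral.integral_eq_sub_of_hasDerivAt_of_le zero_le_one
      (fun t ht => (hd t ht).continuousWithinAt)
      (fun t ht => (hd t (Ioo_subset_Icc_self ht)).hasDerivAt (Icc_mem_nhds ht.1 ht.2)) hint]
    simp only [hxdef, hγ.source, hγ.target]

/-- The curve of entropy-one weightings whose first coordinate is affine. -/
theorem isCurve_affine {p q : Fin 2 → ℝ} (hp : p ∈ figureEight.entropyOne)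
    (hq : q ∈ figureEight.entropyOne) :
    figureEight.IsCurve p q fun t => eightCurve (p 0 + t * (q 0 - p 0)) := by
  have hpos : ∀ t ∈ Icc (0 : ℝ) 1, 0 < p 0 + t * (q 0 - p 0) := by
    intro t ht
    have h1 := apply_zero_pos hp
    have h2 := apply_zero_pos hq
    rcases eq_or_lt_of_le ht.1 with h | h
    · rw [← h]
      linarith
    · nlinarith [ht.2, mul_pos h h2, mul_nonneg (sub_nonneg.2 ht.2) h1.le]
  constructor
  · exact (contDiffOn_eightCurve.of_le (mod_cast le_top)).comp (by fun_prop) hpos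
  · intro t ht
    exact mem_entropyOne_iff.2 (isBalanced_eightCurve (hpos t ht))
  · simpa using (mem_entropyOne_iff.1 hp).eq_eightCurve.symm
  · simpa using (mem_entropyOne_iff.1 hq).eq_eightCurve.symm

/-- Any curve has length at least the absolute value of its signed length, which depends only on the
endpoints. A curve that moves monotonically attains this bound. -/
theorem pressureDist_eq (p q : figureEight.entropyOne) :
    figureEight.pressureDist p q =
      ENNReal.ofReal |arcLength (p.1 0) - arcLength (q.1 0)| := by
  apply le_antisymm
  · refine (iInf₂_le _ (isCurve_affine p.2 q.2)).trans ?_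
    obtain ⟨h1, h2⟩ := pressureLength_eq (isCurve_affine p.2 q.2)
    rw [h1]
    have hx : ∀ t ∈ Icc (0 : ℝ) 1, derivWithin
        (fun t => eightCurve (p.1 0 + t * (q.1 0 - p.1 0)) 0) (Icc 0 1) t = q.1 0 - p.1 0 := by
      intro t ht
      have h3 : HasDerivAt (fun t : ℝ => p.1 0 + t * (q.1 0 - p.1 0)) (q.1 0 - p.1 0) t := by
        simpa using ((hasDerivAt_id t).mul_const (q.1 0 - p.1 0)).const_add (p.1 0)
      exact h3.hasDerivWithinAt.derivWithin (uniqueDiffOn_Icc (zero_lt_one' ℝ) t ht)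
    apply ENNReal.ofReal_le_ofReal
    rw [abs_sub_comm, ← h2]
    have hspeed : ∀ y, 0 ≤ eightSpeed y := fun y => Real.sqrt_nonneg _
    have hcongr : ∀ g : ℝ → ℝ → ℝ, ∫ t in (0 : ℝ)..1, g t (derivWithin
        (fun t => eightCurve (p.1 0 + t * (q.1 0 - p.1 0)) 0) (Icc 0 1) t) =
        ∫ t in (0 : ℝ)..1, g t (q.1 0 - p.1 0) := by
      intro g
      apply intervalIntegral.integral_congr
      intro t ht
      rw [uIcc_of_le zero_le_one] at ht
      simp only [hx t ht]
    rw [hcongr fun t d => |eightSpeed (eightCurve (p.1 0 + t * (q.1 0 - p.1 0)) 0) * d|,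
      hcongr fun t d => eightSpeed (eightCurve (p.1 0 + t * (q.1 0 - p.1 0)) 0) * d]
    -- The derivative of the first coordinate is constant, so it leaves the integral together with
    -- its sign and both sides agree.
    simp only [abs_mul, abs_of_nonneg (hspeed _), intervalIntegral.integral_mul_const]
    rw [abs_of_nonneg (intervalIntegral.integral_nonneg zero_le_one fun t _ => hspeed _)]
  · refine le_iInf₂ fun γ hγ => ?_
    obtain ⟨h1, h2⟩ := pressureLength_eq hγ
    rw [h1, abs_sub_comm, ← h2]
    exact ENNReal.ofReal_le_ofReal (intervalIntegral.abs_integral_le_integral_abs zero_le_one)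

/-! ### Incompleteness -/

theorem injective_arcLength_apply :
    Function.Injective fun p : figureEight.entropyOne => arcLength (p.1 0) := by
  intro p q hpq
  have h := strictMonoOn_arcLength.injOn (apply_zero_pos p.2) (apply_zero_pos q.2) hpq
  ext1
  rw [(mem_entropyOne_iff.1 p.2).eq_eightCurve, (mem_entropyOne_iff.1 q.2).eq_eightCurve, h]

/-- The metric induced by `f` makes `f` an isometry, and an isometric image of a complete space is
closed. -/
theorem isIncompleteMetric_of_injective {X : Type} {d : X → X → ℝ≥0∞} {f : X → ℝ}
    (hf : Function.Injective f) (hd : ∀ p q, d p q = ENNReal.ofReal |f p - f q|)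
    (hrange : ¬ IsClosed (Set.range f)) : IsIncompleteMetric d := by
  let : MetricSpace X := MetricSpace.induced f hf inferInstance
  have hiso : Isometry f := Isometry.of_dist_eq fun _ _ => rfl
  refine ⟨this, fun p q => ?_, fun _ => hrange hiso.isClosedEmbedding.isClosed_range⟩
  rw [hd, ← hiso.edist_eq, edist_dist, Real.dist_eq]

theorem isIncompleteMetric_pressureDist : IsIncompleteMetric figureEight.pressureDist := by
  refine isIncompleteMetric_of_injective injective_arcLength_apply pressureDist_eq fun hclosed => ?_
  have hmem : ∀ᶠ x in 𝓝[>] (0 : ℝ), arcLength x ∈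
      Set.range fun p : figureEight.entropyOne => arcLength (p.1 0) := by
    filter_upwards [self_mem_nhdsWithin] with x hx
    exact ⟨⟨eightCurve x, mem_entropyOne_iff.2 (isBalanced_eightCurve hx)⟩, rfl⟩
  obtain ⟨p, hp⟩ := hclosed.mem_of_tendsto tendsto_arcLength hmem
  exact (arcLength_pos (apply_zero_pos p.2)).ne' hp

end MetricGraph

theorem proposition4p1 :
    -- the pressure metric is well defined on the space of entropy-one weightings
    (∀ l ∈ figureEight.entropyOne,
      (∃! m, figureEight.IsEquilibriumState (figureEight.edgeFun (-l)) m) ∧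
      ∀ φ : Fin 2 → ℝ, figureEight.IsTangent l φ →
        ∃ V : ℝ, Tendsto (figureEight.varianceSeq (figureEight.edgeFun φ) (figureEight.state l))
          atTop (𝓝 V)) ∧
    -- this space is a smooth curve parametrised by the length `x > 0` of the first edge
    figureEight.entropyOne = eightCurve '' Ioi 0 ∧
    ContDiffOn ℝ ∞ eightCurve (Ioi 0) ∧
    -- the pressure norm of the velocity of this curve
    (∀ x : ℝ, 0 < x →
      figureEight.IsTangent (eightCurve x) (deriv eightCurve x) ∧
      figureEight.pressureNorm (eightCurve x) (deriv eightCurve x) ^ 2 =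
        4 * Real.exp x * (Real.exp (2 * x) + 3) /
          (Real.exp (4 * x) + 8 * Real.exp (3 * x) + 6 * Real.exp (2 * x)
            - 24 * Real.exp x + 9)) ∧
    Asymptotics.IsEquivalent (𝓝[>] (0 : ℝ))
      (fun x => figureEight.pressureNorm (eightCurve x) (deriv eightCurve x) ^ 2)
      (fun x => 1 / x) ∧
    -- the end `x → 0` is reached at finite length
    (∫⁻ x in Ioc (0 : ℝ) 1,
      ENNReal.ofReal (figureEight.pressureNorm (eightCurve x) (deriv eightCurve x))) < ⊤ ∧
    -- incompleteness
    IsIncompleteMetric figureEight.pressureDist := by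
  refine ⟨fun l hl => ⟨existsUnique_isEquilibriumState (mem_entropyOne_iff.1 hl),
    fun φ hφ => ⟨_, tendsto_varianceSeq (mem_entropyOne_iff.1 hl) hφ⟩⟩, entropyOne_eq_image,
    contDiffOn_eightCurve, fun x hx => ⟨isTangent_deriv_eightCurve hx,
      pressureNorm_deriv_eightCurve_sq hx⟩, ?_, lintegral_pressureNorm_lt_top,
    isIncompleteMetric_pressureDist⟩
  refine isEquivalent_eightSpeedSq.congr_left ?_
  filter_upwards [self_mem_nhdsWithin] with x hx
  exact (pressureNorm_deriv_eightCurve_sq hx).symm
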